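/- Let $M$ be a (finite-dimensional, Hausdorff, boundaryless) smooth manifold with an almost contact metric structure $(\phi,\xi,\eta,g_M)$: $\phi$ is a smooth $(1,1)$-tensor field, $\xi$ a smooth vector field, $\eta$ a smooth 1-form and $g_M$ a smooth Riemannian metric with $\phi^2=-I+\eta\otimes\xi$, $\phi\xi=0$, $\eta\circ\phi=0$, $\eta(\xi)=1$, $g_M(\phi X,\phi Y)=g_M(X,Y)-\eta(X)\eta(Y)$ and $\eta(X)=g_M(X,\xi)$. Assume that the structure is cosymplectic, that is, it is normal ($[\phi,\phi]+2\,d\eta\otimes\xi=0$, where $[\phi,\phi]$ is the Nijenhuis tensor) and both $\eta$ and the fundamental 2-form $\Phi(X,Y)=g_M(X,\phi Y)$ are closed. Let $(N,g_N)$ be a Riemannian manifold and let $F:M\to N$ be a Riemannian submersion, that is, a smooth map of $M$ onto $N$ of maximal rank whose differential $F_*$ preserves the lengths of horizontal vectors (those in $(\ker F_*)^\perp$). Assume that $F$ is anti-invariant, $\phi(\ker F_*)\subseteq(\ker F_*)^\perp$, and that $(\ker F_*)^\perp=\phi(\ker F_*)\oplus\langle\xi\rangle$ at every point; in particular $\xi$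 is horizontal. Let $\nabla$ be the Levi-Civita connection of $g_M$, let $\mathcal V$ and $\mathcal H$ be the orthogonal projections of $TM$ onto $\ker F_*$ and $(\ker F_*)^\perp$, and let $\mathcal T$ be O'Neill's tensor $\mathcal T_XY=\mathcal H\nabla_{\mathcal VX}\mathcal VY+\mathcal V\nabla_{\mathcal VX}\mathcal HY$. Then $F$ is harmonic, i.e. its tension field $\tau(F)=\sum_i(\nabla F_*)(e_i,e_i)$ vanishes, where $(\nabla F_*)(X,Y)=\nabla^F_X(F_*Y)-F_*(\nabla_XY)$, $\nabla^F$ is the connection on $F^{-1}TN$ pulled back from the Levi-Civita connection of $g_N$, and $(e_i)$ is a local orthonormal frame of $TM$, if and only if for every smooth vertical vector field $V$ (a section of $\ker F_*$) the trace of the endomorphism $\phi\mathcal T_V$ of $TM$ vanishes at every point of $M$. -/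

import Mathlib

open Bundle Manifold VectorField FiberBundle
open scoped ContDiff InnerProductSpace

namespace CosympSubm

noncomputable section

/-! ### The Levi-Civita connection

The Riemannian metric of a manifold `M` modelled on a finite-dimensional real space `E` is the
inner product that the class `RiemannianBundle` puts on the tangent spaces; it is smooth by
`IsContMDiffRiemannianBundle 𝓘(ℝ, E) ∞ E _`. -/

section LeviCivita

variable {E : Type*} [NormedAddCommGroup E] [NormedSpace ℝ E]
  {M : Type*} [TopologicalSpace M] [ChartedSpace E M]

instance finiteDimensional_tangentSpace [FiniteDimensional ℝ E] (x : M) :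
    FiniteDimensional ℝ (TangentSpace 𝓘(ℝ, E) x) :=
  inferInstanceAs (FiniteDimensional ℝ E)

variable [RiemannianBundle (fun x : M ↦ TangentSpace 𝓘(ℝ, E) x)]

/-- The right-hand side of the Koszul formula for `2 g(∇_X Y, Z)`:
`X g(Y,Z) + Y g(X,Z) - Z g(X,Y) + g([X,Y],Z) - g([X,Z],Y) - g([Y,Z],X)`. -/
def koszul (X Y Z : Π x : M, TangentSpace 𝓘(ℝ, E) x) (x : M) : ℝ :=
  mvfderiv 𝓘(ℝ, E) (fun y ↦ ⟪Y y, Z y⟫_ℝ) x (X x)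
    + mvfderiv 𝓘(ℝ, E) (fun y ↦ ⟪X y, Z y⟫_ℝ) x (Y x)
    - mvfderiv 𝓘(ℝ, E) (fun y ↦ ⟪X y, Y y⟫_ℝ) x (Z x)
    + ⟪mlieBracket 𝓘(ℝ, E) X Y x, Z x⟫_ℝ
    - ⟪mlieBracket 𝓘(ℝ, E) X Z x, Y x⟫_ℝ
    - ⟪mlieBracket 𝓘(ℝ, E) Y Z x, X x⟫_ℝ

variable [FiniteDimensional ℝ E] [IsManifold 𝓘(ℝ, E) ∞ M]
  [IsContMDiffRiemannianBundle 𝓘(ℝ, E) ∞ E (fun x : M ↦ TangentSpace 𝓘(ℝ, E) x)]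

variable {X Y Z : Π x : M, TangentSpace 𝓘(ℝ, E) x} {x : M}

set_option linter.unusedSectionVars false

theorem mdiffAt_inner (hX : MDiffAt (T% X) x) (hY : MDiffAt (T% Y) x) :
    MDifferentiableAt 𝓘(ℝ, E) 𝓘(ℝ, ℝ) (fun y ↦ ⟪X y, Y y⟫_ℝ) x :=
  MDifferentiableAt.inner_bundle (E := fun x : M ↦ TangentSpace 𝓘(ℝ, E) x) hX hY

theorem koszul_tensorial_left (hY : MDiffAt (T% Y) x) (hZ : MDiffAt (T% Z) x) :
    TensorialAt 𝓘(ℝ, E) E (fun X : Π x : M, TangentSpace 𝓘(ℝ, E) x ↦ koszul X Y Z x) x where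
  smul {f X} hf hX := by
    have := FiniteDimensional.complete ℝ E
    have h1 := mdiffAt_inner hX hZ
    have h2 := mdiffAt_inner hX hY
    simp only [koszul, Pi.smul_apply', inner_smul_left, inner_smul_right,
      mlieBracket_smul_left hf hX, conj_trivial, map_smul]
    rw [mvfderiv_fun_mul hf h1, mvfderiv_fun_mul hf h2]
    simp [inner_add_left, inner_smul_left]
    rw [real_inner_comm (Y x) (X x)]
    ring
  add {X X'} hX hX' := by
    have := FiniteDimensional.complete ℝ E
    simp only [koszul, Pi.add_apply, inner_add_left, inner_add_right,
      mlieBracket_add_left hX hX', map_add]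
    rw [mvfderiv_fun_add (mdiffAt_inner hX hZ) (mdiffAt_inner hX' hZ),
      mvfderiv_fun_add (mdiffAt_inner hX hY) (mdiffAt_inner hX' hY)]
    simp
    ring

theorem koszul_tensorial_right (hX : MDiffAt (T% X) x) (hY : MDiffAt (T% Y) x) :
    TensorialAt 𝓘(ℝ, E) E (fun Z : Π x : M, TangentSpace 𝓘(ℝ, E) x ↦ koszul X Y Z x) x where
  smul {f Z} hf hZ := by
    have := FiniteDimensional.complete ℝ E
    have h1 := mdiffAt_inner hX hZ
    have h2 := mdiffAt_inner hY hZ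
    simp only [koszul, Pi.smul_apply', inner_smul_right, mlieBracket_smul_right hf hZ, map_smul]
    rw [mvfderiv_fun_mul hf h1, mvfderiv_fun_mul hf h2]
    simp [inner_add_left, inner_smul_left]
    rw [real_inner_comm (Z x) (X x), real_inner_comm (Z x) (Y x)]
    ring
  add {Z Z'} hZ hZ' := by
    have := FiniteDimensional.complete ℝ E
    simp only [koszul, Pi.add_apply, inner_add_left, inner_add_right,
      mlieBracket_add_right hZ hZ', map_add]
    rw [mvfderiv_fun_add (mdiffAt_inner hX hZ) (mdiffAt_inner hX hZ'),
      mvfderiv_fun_add (mdiffAt_inner hY hZ) (mdiffAt_inner hY hZ')]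
    simp
    ring

/-- The Koszul expression, for fixed `Y`, as a bilinear form in the values of `X`, `Z` at `x`. -/
def koszulForm (Y : Π x : M, TangentSpace 𝓘(ℝ, E) x) (x : M) (hY : MDiffAt (T% Y) x) :
    TangentSpace 𝓘(ℝ, E) x →L[ℝ] TangentSpace 𝓘(ℝ, E) x →L[ℝ] ℝ :=
  TensorialAt.mkHom₂ (fun X Z : Π x : M, TangentSpace 𝓘(ℝ, E) x ↦ koszul X Y Z x) x
    (fun _ hZ ↦ koszul_tensorial_left hY hZ) (fun _ hX ↦ koszul_tensorial_right hX hY)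

open Classical in
/-- `v ↦ ∇_v Y` at `x`: the vector that represents half of the Koszul form. Where `Y` is not
differentiable the value is `0`, by convention. -/
def leviCivitaFun (Y : Π x : M, TangentSpace 𝓘(ℝ, E) x) (x : M) :
    TangentSpace 𝓘(ℝ, E) x →L[ℝ] TangentSpace 𝓘(ℝ, E) x :=
  if hY : MDiffAt (T% Y) x then
    ∑ i, (1 / 2 : ℝ) • ((koszulForm Y x hY).flip
      (stdOrthonormalBasis ℝ (TangentSpace 𝓘(ℝ, E) x) i)).smulRight
        (stdOrthonormalBasis ℝ (TangentSpace 𝓘(ℝ, E) x) i)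
  else 0

theorem inner_leviCivitaFun (hX : MDiffAt (T% X) x) (hY : MDiffAt (T% Y) x)
    (hZ : MDiffAt (T% Z) x) :
    ⟪leviCivitaFun Y x (X x), Z x⟫_ℝ = koszul X Y Z x / 2 := by
  have h : koszulForm Y x hY (X x) (Z x) = koszul X Y Z x :=
    TensorialAt.mkHom₂_apply _ _ hX hZ
  rw [← h, leviCivitaFun, dif_pos hY]
  conv_rhs => rw [← (stdOrthonormalBasis ℝ (TangentSpace 𝓘(ℝ, E) x)).sum_repr (Z x)]
  simp [sum_inner, inner_smul_left, OrthonormalBasis.repr_apply_apply, Finset.sum_div]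
  refine Finset.sum_congr rfl fun i _ ↦ ?_
  ring

theorem ext_inner_field {u v : TangentSpace 𝓘(ℝ, E) x}
    (h : ∀ Z : Π x : M, TangentSpace 𝓘(ℝ, E) x, MDiffAt (T% Z) x → ⟪u, Z x⟫_ℝ = ⟪v, Z x⟫_ℝ) :
    u = v := by
  refine ext_inner_right ℝ fun w ↦ ?_
  simpa using h (extend E w) (mdifferentiableAt_extend ..)

theorem ext_field {u v : TangentSpace 𝓘(ℝ, E) x →L[ℝ] TangentSpace 𝓘(ℝ, E) x}
    (h : ∀ X : Π x : M, TangentSpace 𝓘(ℝ, E) x, MDiffAt (T% X) x → u (X x) = v (X x)) :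
    u = v := by
  ext w
  simpa using h (extend E w) (mdifferentiableAt_extend ..)

variable (E M) in
/-- The Levi-Civita connection; `leviCivita E M Y x v` is `∇_v Y` for a vector `v` at `x`. -/
def leviCivita : CovariantDerivative 𝓘(ℝ, E) E (TangentSpace 𝓘(ℝ, E) : M → Type _) where
  toFun := leviCivitaFun
  isCovariantDerivativeOnUniv :=
    { add := by
        intro Y Y' x hY hY' _
        have := FiniteDimensional.complete ℝ E
        refine ext_field fun X hX ↦ ext_inner_field fun Z hZ ↦ ?_
        rw [inner_leviCivitaFun hX (mdifferentiableAt_add_section hY hY') hZ,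
          add_apply, inner_add_left, inner_leviCivitaFun hX hY hZ, inner_leviCivitaFun hX hY' hZ]
        simp only [koszul, Pi.add_apply, inner_add_left, inner_add_right,
          mlieBracket_add_left hY hY', mlieBracket_add_right hY hY', map_add]
        rw [mvfderiv_fun_add (mdiffAt_inner hY hZ) (mdiffAt_inner hY' hZ),
          mvfderiv_fun_add (mdiffAt_inner hX hY) (mdiffAt_inner hX hY')]
        simp
        ring
      leibniz := by
        intro Y f x hY hf _
        have := FiniteDimensional.complete ℝ E
        refine ext_field fun X hX ↦ ext_inner_field fun Z hZ ↦ ?_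
        rw [inner_leviCivitaFun hX (hf.smul_section hY) hZ]
        simp only [add_apply, inner_add_left, smul_apply, inner_smul_left,
          inner_leviCivitaFun hX hY hZ, ContinuousLinearMap.smulRight_apply]
        simp only [koszul, Pi.smul_apply', inner_smul_left, inner_smul_right,
          mlieBracket_smul_left hf hY, mlieBracket_smul_right hf hY, conj_trivial, map_smul]
        rw [mvfderiv_fun_mul hf (mdiffAt_inner hY hZ), mvfderiv_fun_mul hf (mdiffAt_inner hX hY)]
        simp [inner_add_left, inner_smul_left]
        rw [real_inner_comm (X x) (Y x)]
        ring }

theorem inner_leviCivita (hX : MDiffAt (T% X) x) (hY : MDiffAt (T% Y) x)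
    (hZ : MDiffAt (T% Z) x) :
    ⟪leviCivita E M Y x (X x), Z x⟫_ℝ = koszul X Y Z x / 2 :=
  inner_leviCivitaFun hX hY hZ

/-- The connection is torsion-free. -/
theorem leviCivita_torsion : (leviCivita E M).torsion = 0 := by
  rw [CovariantDerivative.torsion_eq_zero_iff]
  intro X Y x hX hY
  refine ext_inner_field fun Z hZ ↦ ?_
  rw [inner_sub_left, inner_leviCivita hX hY hZ, inner_leviCivita hY hX hZ]
  simp only [koszul]
  rw [mlieBracket_swap_apply (V := Y) (W := X)]
  simp only [real_inner_comm (X _) (Y _), inner_neg_left]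
  ring

/-- The connection is compatible with the metric. -/
theorem leviCivita_metric (hX : MDiffAt (T% X) x) (hY : MDiffAt (T% Y) x)
    (hZ : MDiffAt (T% Z) x) :
    mvfderiv 𝓘(ℝ, E) (fun y ↦ ⟪Y y, Z y⟫_ℝ) x (X x) =
      ⟪leviCivita E M Y x (X x), Z x⟫_ℝ + ⟪Y x, leviCivita E M Z x (X x)⟫_ℝ := by
  rw [real_inner_comm _ (Y x), inner_leviCivita hX hY hZ, inner_leviCivita hX hZ hY]
  simp only [koszul]
  rw [mlieBracket_swap_apply (V := Z) (W := Y)]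
  simp only [real_inner_comm (Y _) (Z _), inner_neg_left]
  ring

end LeviCivita

/-! ### Cosymplectic structures -/

section Cosymplectic

variable (E : Type*) [NormedAddCommGroup E] [NormedSpace ℝ E]
  (M : Type*) [TopologicalSpace M] [ChartedSpace E M] [IsManifold 𝓘(ℝ, E) ∞ M]
  [RiemannianBundle (fun x : M ↦ TangentSpace 𝓘(ℝ, E) x)]

/-- An almost contact metric structure `(φ, ξ, η, g)`, where `g` is the given metric of `M`. -/
structure AlmostContactMetric where
  /-- The tensor field `φ` of type `(1,1)`. -/
  phi : Π x : M, TangentSpace 𝓘(ℝ, E) x →L[ℝ] TangentSpace 𝓘(ℝ, E) x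
  /-- The characteristic vector field `ξ`. -/
  xi : Π x : M, TangentSpace 𝓘(ℝ, E) x
  /-- The 1-form `η`. -/
  eta : Π x : M, TangentSpace 𝓘(ℝ, E) x →L[ℝ] ℝ
  contMDiff_phi : ContMDiff 𝓘(ℝ, E) (𝓘(ℝ, E).prod 𝓘(ℝ, E →L[ℝ] E)) ∞
    (fun x ↦ TotalSpace.mk' (E →L[ℝ] E)
      (E := fun x : M ↦ TangentSpace 𝓘(ℝ, E) x →L[ℝ] TangentSpace 𝓘(ℝ, E) x) x (phi x))
  contMDiff_xi : ContMDiff 𝓘(ℝ, E) (𝓘(ℝ, E).prod 𝓘(ℝ, E)) ∞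
    (fun x ↦ TotalSpace.mk' E (E := fun x : M ↦ TangentSpace 𝓘(ℝ, E) x) x (xi x))
  contMDiff_eta : ContMDiff 𝓘(ℝ, E) (𝓘(ℝ, E).prod 𝓘(ℝ, E →L[ℝ] ℝ)) ∞
    (fun x ↦ TotalSpace.mk' (E →L[ℝ] ℝ)
      (E := fun x : M ↦ TangentSpace 𝓘(ℝ, E) x →L[ℝ] ℝ) x (eta x))
  phi_phi : ∀ (x : M) (v : TangentSpace 𝓘(ℝ, E) x), phi x (phi x v) = -v + eta x v • xi x
  phi_xi : ∀ x : M, phi x (xi x) = 0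
  eta_phi : ∀ (x : M) (v : TangentSpace 𝓘(ℝ, E) x), eta x (phi x v) = 0
  eta_xi : ∀ x : M, eta x (xi x) = 1
  inner_phi_phi : ∀ (x : M) (u v : TangentSpace 𝓘(ℝ, E) x),
    ⟪phi x u, phi x v⟫_ℝ = ⟪u, v⟫_ℝ - eta x u * eta x v
  eta_eq_inner : ∀ (x : M) (v : TangentSpace 𝓘(ℝ, E) x), eta x v = ⟪v, xi x⟫_ℝ

end Cosymplectic

section CosymplecticDefs

variable {E : Type*} [NormedAddCommGroup E] [NormedSpace ℝ E]
  {M : Type*} [TopologicalSpace M] [ChartedSpace E M] [IsManifold 𝓘(ℝ, E) ∞ M]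

/-- Smooth vector fields: the elements of `Γ(TM)`. -/
def IsSmoothField (X : Π x : M, TangentSpace 𝓘(ℝ, E) x) : Prop :=
  ContMDiff 𝓘(ℝ, E) (𝓘(ℝ, E).prod 𝓘(ℝ, E)) ∞
    (fun x ↦ TotalSpace.mk' E (E := fun x : M ↦ TangentSpace 𝓘(ℝ, E) x) x (X x))

/-- Twice the exterior derivative of a 1-form, evaluated on vector fields:
`2 dα(X,Y) = X α(Y) - Y α(X) - α([X,Y])`, with the convention that puts the factor `1/2` into
`dα`. -/
def twiceExtDeriv (α : Π x : M, TangentSpace 𝓘(ℝ, E) x →L[ℝ] ℝ)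
    (X Y : Π x : M, TangentSpace 𝓘(ℝ, E) x) (x : M) : ℝ :=
  mvfderiv 𝓘(ℝ, E) (fun y ↦ α y (Y y)) x (X x)
    - mvfderiv 𝓘(ℝ, E) (fun y ↦ α y (X y)) x (Y x)
    - α x (mlieBracket 𝓘(ℝ, E) X Y x)

/-- The Nijenhuis tensor
`[φ,φ](X,Y) = φ²[X,Y] + [φX,φY] - φ[φX,Y] - φ[X,φY]`. -/
def nijenhuis (φ : Π x : M, TangentSpace 𝓘(ℝ, E) x →L[ℝ] TangentSpace 𝓘(ℝ, E) x)
    (X Y : Π x : M, TangentSpace 𝓘(ℝ, E) x) (x : M) : TangentSpace 𝓘(ℝ, E) x :=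
  φ x (φ x (mlieBracket 𝓘(ℝ, E) X Y x))
    + mlieBracket 𝓘(ℝ, E) (fun y ↦ φ y (X y)) (fun y ↦ φ y (Y y)) x
    - φ x (mlieBracket 𝓘(ℝ, E) (fun y ↦ φ y (X y)) Y x)
    - φ x (mlieBracket 𝓘(ℝ, E) X (fun y ↦ φ y (Y y)) x)

variable [RiemannianBundle (fun x : M ↦ TangentSpace 𝓘(ℝ, E) x)]

namespace AlmostContactMetric

variable (S : AlmostContactMetric E M)

/-- The fundamental 2-form `Φ(X,Y) = g(X, φY)`, on vector fields. -/
def fundForm (X Y : Π x : M, TangentSpace 𝓘(ℝ, E) x) (x : M) : ℝ :=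
  ⟪X x, S.phi x (Y x)⟫_ℝ

/-- Three times the exterior derivative of `Φ`, evaluated on vector fields:
`3 dΦ(X,Y,Z) = X Φ(Y,Z) + Y Φ(Z,X) + Z Φ(X,Y) - Φ([X,Y],Z) - Φ([Y,Z],X) - Φ([Z,X],Y)`. -/
def thriceExtDerivFundForm (X Y Z : Π x : M, TangentSpace 𝓘(ℝ, E) x) (x : M) : ℝ :=
  mvfderiv 𝓘(ℝ, E) (S.fundForm Y Z) x (X x)
    + mvfderiv 𝓘(ℝ, E) (S.fundForm Z X) x (Y x)
    + mvfderiv 𝓘(ℝ, E) (S.fundForm X Y) x (Z x)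
    - S.fundForm (mlieBracket 𝓘(ℝ, E) X Y) Z x
    - S.fundForm (mlieBracket 𝓘(ℝ, E) Y Z) X x
    - S.fundForm (mlieBracket 𝓘(ℝ, E) Z X) Y x

/-- Normality: `[φ,φ] + 2 dη ⊗ ξ = 0`. -/
def IsNormal : Prop :=
  ∀ X Y : Π x : M, TangentSpace 𝓘(ℝ, E) x, IsSmoothField X → IsSmoothField Y →
    ∀ x : M, nijenhuis S.phi X Y x + twiceExtDeriv S.eta X Y x • S.xi x = 0

/-- Cosymplectic: normal, with `η` and `Φ` closed. -/
structure IsCosymplectic : Prop where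
  normal : S.IsNormal
  eta_closed : ∀ X Y : Π x : M, TangentSpace 𝓘(ℝ, E) x, IsSmoothField X → IsSmoothField Y →
    ∀ x : M, twiceExtDeriv S.eta X Y x = 0
  fundForm_closed : ∀ X Y Z : Π x : M, TangentSpace 𝓘(ℝ, E) x,
    IsSmoothField X → IsSmoothField Y → IsSmoothField Z →
    ∀ x : M, S.thriceExtDerivFundForm X Y Z x = 0

end AlmostContactMetric

end CosymplecticDefs

/-! ### Riemannian submersions, the tensor `T`, harmonic maps -/

section Submersion

variable {E : Type*} [NormedAddCommGroup E] [NormedSpace ℝ E] [FiniteDimensional ℝ E]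
  {M : Type*} [TopologicalSpace M] [ChartedSpace E M]
  [RiemannianBundle (fun x : M ↦ TangentSpace 𝓘(ℝ, E) x)]
  {E' : Type*} [NormedAddCommGroup E'] [NormedSpace ℝ E']
  {N : Type*} [TopologicalSpace N] [ChartedSpace E' N]

/-- The vertical space `ker F_*` at `p`. -/
def vertical (E E' : Type*) [NormedAddCommGroup E] [NormedSpace ℝ E]
    [NormedAddCommGroup E'] [NormedSpace ℝ E'] {M : Type*} [TopologicalSpace M]
    [ChartedSpace E M]
    {N : Type*} [TopologicalSpace N] [ChartedSpace E' N]
    (F : M → N) (p : M) : Submodule ℝ (TangentSpace 𝓘(ℝ, E) p) :=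
  (mfderiv 𝓘(ℝ, E) 𝓘(ℝ, E') F p).ker

/-- The horizontal space `(ker F_*)^⊥` at `p`. -/
def horizontal (E E' : Type*) [NormedAddCommGroup E] [NormedSpace ℝ E]
    [NormedAddCommGroup E'] [NormedSpace ℝ E'] {M : Type*} [TopologicalSpace M]
    [ChartedSpace E M] [RiemannianBundle (fun x : M ↦ TangentSpace 𝓘(ℝ, E) x)]
    {N : Type*} [TopologicalSpace N] [ChartedSpace E' N]
    (F : M → N) (p : M) : Submodule ℝ (TangentSpace 𝓘(ℝ, E) p) :=
  (vertical E E' F p)ᗮ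

variable (E E') in
/-- The orthogonal projection `𝒱` onto `ker F_*`, on vector fields. -/
def vertField (F : M → N) (X : Π x : M, TangentSpace 𝓘(ℝ, E) x) (p : M) :
    TangentSpace 𝓘(ℝ, E) p :=
  (vertical E E' F p).starProjection (X p)

variable (E E') in
/-- The orthogonal projection `ℋ` onto `(ker F_*)^⊥`, on vector fields. -/
def horField (F : M → N) (X : Π x : M, TangentSpace 𝓘(ℝ, E) x) (p : M) :
    TangentSpace 𝓘(ℝ, E) p :=
  (horizontal E E' F p).starProjection (X p)

variable (E E') in
/-- O'Neill's tensor `T_X Y = ℋ ∇_{𝒱X} 𝒱Y + 𝒱 ∇_{𝒱X} ℋY`. -/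
def oneillT [IsManifold 𝓘(ℝ, E) ∞ M]
    [IsContMDiffRiemannianBundle 𝓘(ℝ, E) ∞ E (fun x : M ↦ TangentSpace 𝓘(ℝ, E) x)]
    (F : M → N) (X Y : Π x : M, TangentSpace 𝓘(ℝ, E) x) : Π x : M, TangentSpace 𝓘(ℝ, E) x :=
  horField E E' F
      (fun p ↦ leviCivita E M (vertField E E' F Y) p (vertField E E' F X p))
    + vertField E E' F
      (fun p ↦ leviCivita E M (horField E E' F Y) p (vertField E E' F X p))

/-- The trace at `p` of a tensor field of type `(1,1)`, given as an operator on vector fields: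
`∑ i, g(A e_i, e_i)` for an orthonormal basis `e_i` of the tangent space at `p`, each `e_i` being
extended to a vector field that is smooth near `p`. -/
def traceAt [IsManifold 𝓘(ℝ, E) ∞ M]
    (A : (Π x : M, TangentSpace 𝓘(ℝ, E) x) → Π x : M, TangentSpace 𝓘(ℝ, E) x)
    (p : M) : ℝ :=
  ∑ i, ⟪A (extend E (stdOrthonormalBasis ℝ (TangentSpace 𝓘(ℝ, E) p) i)) p,
    stdOrthonormalBasis ℝ (TangentSpace 𝓘(ℝ, E) p) i⟫_ℝ

/-- Riemannian submersions. -/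
structure IsRiemannianSubmersion (E E' : Type*) [NormedAddCommGroup E] [NormedSpace ℝ E]
    [NormedAddCommGroup E'] [NormedSpace ℝ E'] {M : Type*} [TopologicalSpace M]
    [ChartedSpace E M] [RiemannianBundle (fun x : M ↦ TangentSpace 𝓘(ℝ, E) x)]
    {N : Type*} [TopologicalSpace N] [ChartedSpace E' N]
    [RiemannianBundle (fun x : N ↦ TangentSpace 𝓘(ℝ, E') x)] (F : M → N) : Prop where
  smooth : ContMDiff 𝓘(ℝ, E) 𝓘(ℝ, E') ∞ F
  surjective : Function.Surjective F
  maximal_rank : ∀ p : M, Function.Surjective (mfderiv 𝓘(ℝ, E) 𝓘(ℝ, E') F p)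
  norm_horizontal : ∀ p : M, ∀ v ∈ horizontal E E' F p,
    ‖mfderiv 𝓘(ℝ, E) 𝓘(ℝ, E') F p v‖ = ‖v‖

variable [IsManifold 𝓘(ℝ, E) ∞ M]
  [IsContMDiffRiemannianBundle 𝓘(ℝ, E) ∞ E (fun x : M ↦ TangentSpace 𝓘(ℝ, E) x)]
  [FiniteDimensional ℝ E'] [IsManifold 𝓘(ℝ, E') ∞ N]
  [RiemannianBundle (fun x : N ↦ TangentSpace 𝓘(ℝ, E') x)]
  [IsContMDiffRiemannianBundle 𝓘(ℝ, E') ∞ E' (fun x : N ↦ TangentSpace 𝓘(ℝ, E') x)]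

/-- The pullback connection `∇^F_v s` of a section `s` of `F⁻¹TN`. If `E_j` is the local frame of
`TN` near `F p` given by a basis of `E'` in the trivialization at `F p`, and `s = ∑ s^j (E_j ∘ F)`,
then `∇^F_v s = ∑ v(s^j) E_j + s^j(p) ∇_{F_* v} E_j`. The first sum is the derivative of the
coordinate expression of `s`; in the second one, `∑ s^j(p) E_j` is `extend E' (s p)`. -/
def pullbackNabla (F : M → N) (s : Π p : M, TangentSpace 𝓘(ℝ, E') (F p)) (p : M)
    (v : TangentSpace 𝓘(ℝ, E) p) : TangentSpace 𝓘(ℝ, E') (F p) :=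
  (trivializationAt E' (fun y : N ↦ TangentSpace 𝓘(ℝ, E') y) (F p)).symm (F p)
      (mvfderiv 𝓘(ℝ, E) (fun q : M ↦
        (trivializationAt E' (fun y : N ↦ TangentSpace 𝓘(ℝ, E') y) (F p)
          (TotalSpace.mk' E' (E := fun y : N ↦ TangentSpace 𝓘(ℝ, E') y) (F q) (s q))).2) p v)
    + leviCivita E' N (extend E' (s p)) (F p) (mfderiv 𝓘(ℝ, E) 𝓘(ℝ, E') F p v)

variable (E E') in
/-- The second fundamental form `(∇F_*)(X,Y) = ∇^F_X (F_* Y) - F_*(∇_X Y)`. -/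
def secondFundForm (F : M → N) (X Y : Π x : M, TangentSpace 𝓘(ℝ, E) x) (p : M) :
    TangentSpace 𝓘(ℝ, E') (F p) :=
  pullbackNabla F (fun q ↦ mfderiv 𝓘(ℝ, E) 𝓘(ℝ, E') F q (Y q)) p (X p)
    - mfderiv 𝓘(ℝ, E) 𝓘(ℝ, E') F p (leviCivita E M Y p (X p))

variable (E E') in
/-- The tension field `τ(F) = ∑ i, (∇F_*)(e_i, e_i)`, with `e_i` an orthonormal basis of the
tangent space at `p`, each `e_i` being extended to a vector field that is smooth near `p`. -/
def tension (F : M → N) (p : M) : TangentSpace 𝓘(ℝ, E') (F p) :=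
  ∑ i, secondFundForm E E' F
    (extend E (stdOrthonormalBasis ℝ (TangentSpace 𝓘(ℝ, E) p) i))
    (extend E (stdOrthonormalBasis ℝ (TangentSpace 𝓘(ℝ, E) p) i)) p

variable (E E') in
/-- Harmonic maps: smooth maps with vanishing tension field. -/
def IsHarmonic (F : M → N) : Prop :=
  ContMDiff 𝓘(ℝ, E) 𝓘(ℝ, E') ∞ F ∧ ∀ p : M, tension E E' F p = 0

end Submersion

end

end CosympSubm

/-! Fix p, an orthonormal basis u_j of ker F_* at p, and smooth vertical fields U_j with U_j(p) =
u_j. Put H = Σ_j ∇_{U_j} U_j at p. Both sides of the equivalence are conditions on H, and they agree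
point by point (`tension_eq_zero_iff`).

Since (ker F_*)^⊥ = φ(ker F_*) + ⟨ξ⟩, the vectors u_j, φu_j, ξ form an orthonormal basis of T_pM
(`exists_orthonormalBasis`). The second fundamental form of a Riemannian submersion vanishes on
pairs of horizontal vectors (`secondFundFormAt_of_horizontal`): it is symmetric in its arguments,
while its pairing with F_* of a horizontal vector is skew. Only the u_j contribute to the tension,
and F_* U_j = 0, so τ(F) = -F_* H (`tension_eq_neg_mfderiv`). Hence τ(F) = 0 at p iff H is vertical,
that is, iff H is orthogonal to φ(ker F_*) and to ξ.

The cosymplectic condition gives ∇φ = 0 (`nablaPhi_eq_zero`) and hence ∇ξ = 0 (`leviCivita_xi`). The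
latter makes H orthogonal to ξ in every case. For the rest, T_V is skew-symmetric, so u_j and φu_j
contribute equally to the trace of φT_V, and ξ contributes nothing because φξ = 0. With ∇φ = 0 and
the symmetry of T on vertical vectors, g(T_V u_j, φu_j) = g(∇_{U_j} V, φU_j) = g(φV, ∇_{U_j} U_j).
So tr φT_V = -2 g(φV, H) (`traceAt_phi_oneillT`), which vanishes for all V iff H is orthogonal to
φ(ker F_*). -/

namespace CosympSubm

/-! ### Vector fields with constant chart coordinates -/

section Fields

variable {E : Type*} [NormedAddCommGroup E] [NormedSpace ℝ E]
  {M : Type*} [TopologicalSpace M] [ChartedSpace E M] [IsManifold 𝓘(ℝ, E) ∞ M]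

/-- The constant vector field on a normed space. -/
def constField (w : E) : Π z : E, TangentSpace 𝓘(ℝ, E) z := fun _ ↦ w

theorem mdifferentiableAt_constField (w z : E) : MDiffAt (T% (constField w)) z := by
  rw [mdifferentiableAt_section (F := E) (E := (TangentSpace 𝓘(ℝ, E) : E → Type _))]
  simp only [trivializationAt_model_space_apply]
  exact mdifferentiableAt_const

theorem mlieBracket_constField (u w z : E) :
    mlieBracket 𝓘(ℝ, E) (constField u) (constField w) z = 0 := by
  rw [← mlieBracketWithin_univ, mlieBracketWithin_eq_lieBracketWithin]
  unfold constField
  simp [lieBracketWithin]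
  rfl

/-- The trivialization of the tangent bundle at `x` is the derivative of the chart at `x`, so
constant coordinates there mean a constant field in the chart. -/
theorem extend_eventually_eq_mpullback {x : M} (v : TangentSpace 𝓘(ℝ, E) x) :
    (extend E v : Π y : M, TangentSpace 𝓘(ℝ, E) y) =ᶠ[nhds x]
      (mpullback 𝓘(ℝ, E) 𝓘(ℝ, E) (extChartAt 𝓘(ℝ, E) x)
        (constField (trivializationAt E (TangentSpace 𝓘(ℝ, E) : M → Type _) x ⟨x, v⟩).2) :
          Π y : M, TangentSpace 𝓘(ℝ, E) y) := by
  filter_upwards [chart_source_mem_nhds E x] with y hy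
  have hb : y ∈ (trivializationAt E (TangentSpace 𝓘(ℝ, E)) x).baseSet := by simpa using hy
  rw [mpullback_apply, ← TangentBundle.continuousLinearMapAt_trivializationAt hy]
  have h : (trivializationAt E (TangentSpace 𝓘(ℝ, E)) x).continuousLinearMapAt ℝ y =
      ((trivializationAt E (TangentSpace 𝓘(ℝ, E)) x).continuousLinearEquivAt ℝ y hb :
        TangentSpace 𝓘(ℝ, E) y →L[ℝ] E) := by
    ext u
    rw [Trivialization.continuousLinearMapAt_apply]
    exact congrFun (Trivialization.coe_linearMapAt_of_mem _ hb) u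
  rw [h]
  erw [ContinuousLinearMap.inverse_equiv]
  rfl

/-- Pullback by the chart commutes with brackets, and constant fields on `E` commute. Tensorial
identities can therefore be checked on extensions, where bracket terms drop out. -/
theorem mlieBracket_extend_extend [CompleteSpace E] {x : M} (u v : TangentSpace 𝓘(ℝ, E) x) :
    mlieBracket 𝓘(ℝ, E) (extend E u : Π y : M, TangentSpace 𝓘(ℝ, E) y) (extend E v) x = 0 := by
  have : IsManifold 𝓘(ℝ, E) (minSmoothness ℝ 2) M := by
    rw [minSmoothness_of_isRCLikeNormedField]
    infer_instance
  rw [(extend_eventually_eq_mpullback u).mlieBracket_vectorField_eq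
    (extend_eventually_eq_mpullback v), ← mpullback_mlieBracket (n := ∞)
      (mdifferentiableAt_constField _ _) (mdifferentiableAt_constField _ _)
      contMDiffAt_extChartAt (by rw [minSmoothness_of_isRCLikeNormedField]; exact ENat.LEInfty.out),
    mpullback_apply, mlieBracket_constField, map_zero]

theorem contMDiffOn_extend {x : M} (v : TangentSpace 𝓘(ℝ, E) x) :
    CMDiff[(chartAt E x).source] ∞ (T% (extend E v : Π y : M, TangentSpace 𝓘(ℝ, E) y)) := by
  have h := (trivializationAt E (TangentSpace 𝓘(ℝ, E) :
    M → Type _) x).contMDiffOn_section_baseSet_iff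
    (IB := 𝓘(ℝ, E)) (n := ∞) (s := (extend E v : Π y : M, TangentSpace 𝓘(ℝ, E) y))
  rw [TangentBundle.trivializationAt_baseSet] at h
  rw [h]
  apply (contMDiffOn_const
    (c := (trivializationAt E (TangentSpace 𝓘(ℝ, E) : M → Type _) x ⟨x, v⟩).2)).congr
  intro y hy
  have hb : y ∈ (trivializationAt E (TangentSpace 𝓘(ℝ, E)) x).baseSet := by simpa using hy
  change ((trivializationAt E (TangentSpace 𝓘(ℝ, E) : M → Type _) x) ⟨y,
    (trivializationAt E (TangentSpace 𝓘(ℝ, E) : M → Type _) x).symm y _⟩).2 = _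
  rw [Trivialization.apply_mk_symm _ hb]

theorem IsSmoothField.contMDiffAt {X : Π x : M, TangentSpace 𝓘(ℝ, E) x}
    (hX : IsSmoothField X) (x : M) : CMDiffAt ∞ (T% X) x :=
  ContMDiff.contMDiffAt hX

theorem IsSmoothField.mdifferentiableAt {X : Π x : M, TangentSpace 𝓘(ℝ, E) x}
    (hX : IsSmoothField X) (x : M) : MDiffAt (T% X) x :=
  (hX.contMDiffAt x).mdifferentiableAt (by simp)

/-- Every tangent vector is the value of a smooth vector field that is constant, in the chart at
the base point, near that point. -/
theorem exists_isSmoothField_eventuallyEq_extend [FiniteDimensional ℝ E] [T2Space M] {x : M}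
    (v : TangentSpace 𝓘(ℝ, E) x) :
    ∃ X : Π x : M, TangentSpace 𝓘(ℝ, E) x, IsSmoothField X ∧
      ∀ᶠ y in nhds x, X y = (extend E v : Π y : M, TangentSpace 𝓘(ℝ, E) y) y := by
  obtain ⟨f⟩ : Nonempty (SmoothBumpFunction 𝓘(ℝ, E) x) := inferInstance
  refine ⟨(f : M → ℝ) • extend E v, ?_, ?_⟩
  · exact ContMDiffOn.smul_section_of_tsupport f.contMDiff.contMDiffOn
      (chartAt E x).open_source f.tsupport_subset_chartAt_source (contMDiffOn_extend v)
  · filter_upwards [f.eventuallyEq_one] with y hy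
    simp only [Pi.smul_apply', hy, Pi.one_apply, one_smul]

theorem exists_isSmoothField_apply_eq [FiniteDimensional ℝ E] [T2Space M] {x : M}
    (v : TangentSpace 𝓘(ℝ, E) x) :
    ∃ X : Π x : M, TangentSpace 𝓘(ℝ, E) x, IsSmoothField X ∧ X x = v := by
  obtain ⟨X, hX, h⟩ := exists_isSmoothField_eventuallyEq_extend v
  exact ⟨X, hX, by simpa using h.self_of_nhds⟩

end Fields

/-! ### Smoothness of a vector field tested by inner products -/

section Gram

variable {E : Type*} [NormedAddCommGroup E] [NormedSpace ℝ E] [FiniteDimensional ℝ E]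
  {M : Type*} [TopologicalSpace M] [ChartedSpace E M] [IsManifold 𝓘(ℝ, E) ∞ M]
  [RiemannianBundle (fun x : M ↦ TangentSpace 𝓘(ℝ, E) x)]
  [IsContMDiffRiemannianBundle 𝓘(ℝ, E) ∞ E (fun x : M ↦ TangentSpace 𝓘(ℝ, E) x)]

/-- The Gram matrix of a family of vectors, as an operator. -/
noncomputable def gramMap {V ι : Type*} [NormedAddCommGroup V] [InnerProductSpace ℝ V] [Fintype ι]
    [DecidableEq ι] (s : ι → V) : (ι → ℝ) →L[ℝ] (ι → ℝ) :=
  ∑ i, ∑ j, ⟪s i, s j⟫_ℝ •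
    (ContinuousLinearMap.proj (R := ℝ) (φ := fun _ : ι ↦ ℝ) i).smulRight (Pi.single j (1 : ℝ))

theorem gramMap_apply {V ι : Type*} [NormedAddCommGroup V] [InnerProductSpace ℝ V] [Fintype ι]
    [DecidableEq ι] (s : ι → V) (a : ι → ℝ) (j : ι) :
    gramMap s a j = ⟪∑ i, a i • s i, s j⟫_ℝ := by
  simp [gramMap, sum_apply, sum_inner, inner_smul_left, Pi.single_apply, mul_comm]

/-- A vector `a` in the kernel gives a combination `∑ i, a i • s i` orthogonal to every `s j`, hence
to itself. -/
theorem gramMap_isInvertible {V ι : Type*} [NormedAddCommGroup V] [InnerProductSpace ℝ V]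
    [Fintype ι] [DecidableEq ι] {s : ι → V} (hs : LinearIndependent ℝ s) :
    ∃ e : (ι → ℝ) ≃L[ℝ] (ι → ℝ), (e : (ι → ℝ) →L[ℝ] (ι → ℝ)) = gramMap s := by
  have hinj : Function.Injective (gramMap s : (ι → ℝ) →ₗ[ℝ] (ι → ℝ)) := by
    rw [← LinearMap.ker_eq_bot, LinearMap.ker_eq_bot']
    intro a ha
    have h0 : ⟪∑ i, a i • s i, ∑ i, a i • s i⟫_ℝ = 0 := by
      rw [inner_sum]
      refine Finset.sum_eq_zero fun j _ ↦ ?_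
      rw [inner_smul_right, ← gramMap_apply]
      have := congrFun ha j
      simp only [ContinuousLinearMap.coe_coe, Pi.zero_apply] at this
      rw [this, mul_zero]
    rw [inner_self_eq_zero] at h0
    exact funext fun i ↦ Fintype.linearIndependent_iff.1 hs a h0 i
  exact ⟨(LinearEquiv.ofInjectiveEndo _ hinj).toContinuousLinearEquiv, by ext; rfl⟩

/-- A vector field is smooth at a point if so are its inner products with all vector fields that
are smooth there. -/
theorem contMDiffAt_of_inner {W : Π x : M, TangentSpace 𝓘(ℝ, E) x} {x : M}
    (h : ∀ Y : Π x : M, TangentSpace 𝓘(ℝ, E) x, CMDiffAt ∞ (T% Y) x →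
      CMDiffAt ∞ (fun y ↦ ⟪W y, Y y⟫_ℝ) x) :
    CMDiffAt ∞ (T% W) x := by
  classical
  let t := trivializationAt E (TangentSpace 𝓘(ℝ, E) : M → Type _) x
  have hx : x ∈ t.baseSet := FiberBundle.mem_baseSet_trivializationAt' x
  let b := Module.finBasis ℝ E
  let s := t.localFrame b
  have hs (i) : CMDiffAt ∞ (T% (s i)) x := contMDiffAt_localFrame_of_mem ∞ _ b i hx
  have hli {y} (hy : y ∈ t.baseSet) : LinearIndependent ℝ (fun i ↦ s i y) :=
    (t.isLocalFrameOn_localFrame_baseSet 𝓘(ℝ, E) ∞ b).linearIndependent hy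
  have hgram : CMDiffAt ∞ (fun y ↦ gramMap (fun i ↦ s i y)) x := by
    unfold gramMap
    refine ContMDiffAt.sum fun i _ ↦ ContMDiffAt.sum fun j _ ↦ ?_
    exact ContMDiffAt.smul (ContMDiffAt.inner_bundle
      (E := fun x : M ↦ TangentSpace 𝓘(ℝ, E) x) (hs i) (hs j)) contMDiffAt_const
  have hd : ContMDiffAt 𝓘(ℝ, E) 𝓘(ℝ, Fin (Module.finrank ℝ E) → ℝ) ∞
      (fun y ↦ (fun j ↦ ⟪W y, s j y⟫_ℝ)) x :=
    contMDiffAt_pi_space.2 fun j ↦ h _ (hs j)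
  obtain ⟨e, he⟩ := gramMap_isInvertible (hli hx)
  have hinv : CMDiffAt ∞ (fun y ↦ (gramMap (fun i ↦ s i y)).inverse) x := by
    refine ContMDiffAt.comp (I' := 𝓘(ℝ, (Fin _ → ℝ) →L[ℝ] (Fin _ → ℝ))) x
      (g := ContinuousLinearMap.inverse) ?_ hgram
    rw [← he]
    exact (contDiffAt_map_inverse e).contMDiffAt
  -- The inner products of `W` with the frame are the Gram matrix applied to the frame coefficients
  -- of `W`; the inverse matrix recovers these coefficients smoothly.
  have key : ContMDiffAt 𝓘(ℝ, E) 𝓘(ℝ, Fin (Module.finrank ℝ E) → ℝ) ∞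
      (fun y ↦ (gramMap (fun i ↦ s i y)).inverse (fun j ↦ ⟪W y, s j y⟫_ℝ)) x :=
    hinv.clm_apply hd
  rw [contMDiffAt_iff_localFrameCoeff (e := t) (I := 𝓘(ℝ, E)) b hx]
  intro i
  refine (contMDiffAt_pi_space.1 key i).congr_of_eventuallyEq ?_
  filter_upwards [t.open_baseSet.mem_nhds hx] with y hy
  obtain ⟨e, he⟩ := gramMap_isInvertible (hli hy)
  have hW := t.eq_sum_localFrameCoeff_smul (I := 𝓘(ℝ, E)) (b := b) (s := W) hy
  have : (fun j ↦ ⟪W y, s j y⟫_ℝ) =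
      gramMap (fun i ↦ s i y) (fun i ↦ t.localFrameCoeff 𝓘(ℝ, E) b i y (W y)) := by
    ext j
    rw [gramMap_apply]
    congr 1
  rw [this, ← he, ContinuousLinearMap.inverse_equiv]
  simp

end Gram

/-! ### Second derivatives and the commutator formula -/

section SecondDerivative

set_option linter.unusedSectionVars false

variable {E : Type*} [NormedAddCommGroup E] [NormedSpace ℝ E]
  {M : Type*} [TopologicalSpace M] [ChartedSpace E M] [IsManifold 𝓘(ℝ, E) ∞ M]
  {E' : Type*} [NormedAddCommGroup E'] [NormedSpace ℝ E']
  {N : Type*} [TopologicalSpace N] [ChartedSpace E' N] [IsManifold 𝓘(ℝ, E') ∞ N]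

theorem mvfderiv_congr_of_eventuallyEq {f g : M → E'} {x : M} (h : f =ᶠ[nhds x] g) :
    mvfderiv 𝓘(ℝ, E) f x = mvfderiv 𝓘(ℝ, E) g x := by
  ext v
  exact congrArg (fun L : E →L[ℝ] E' ↦ L v) h.mfderiv_eq

theorem mvfderiv_eq_fderiv {f : E → E'} {x : E} : mvfderiv 𝓘(ℝ, E) f x = fderiv ℝ f x := by
  ext v
  exact congrArg (fun L : E →L[ℝ] E' ↦ L v) mfderiv_eq_fderiv

theorem mdifferentiableAt_mfderiv_apply {F : M → N} {x : M} {Y : Π x : M, TangentSpace 𝓘(ℝ, E) x}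
    (hF : CMDiffAt ∞ F x) (hY : MDiffAt (T% Y) x) :
    MDifferentiableAt 𝓘(ℝ, E) (𝓘(ℝ, E').prod 𝓘(ℝ, E'))
      (fun y ↦ TotalSpace.mk' E' (E := fun z : N ↦ TangentSpace 𝓘(ℝ, E') z) (F y)
        (mfderiv 𝓘(ℝ, E) 𝓘(ℝ, E') F y (Y y))) x := by
  have h := ContMDiffAt.mfderiv_const (m := 1) hF (by norm_num; exact ENat.LEInfty.out)
  exact MDifferentiableAt.clm_apply_of_inCoordinates (h.mdifferentiableAt one_ne_zero) hY
    (hF.mdifferentiableAt (by simp))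

theorem contMDiffAt_mfderiv_apply {F : M → N} {x : M} {Y : Π x : M, TangentSpace 𝓘(ℝ, E) x}
    (hF : CMDiffAt ∞ F x) (hY : CMDiffAt ∞ (T% Y) x) :
    ContMDiffAt 𝓘(ℝ, E) (𝓘(ℝ, E').prod 𝓘(ℝ, E')) ∞
      (fun y ↦ TotalSpace.mk' E' (E := fun z : N ↦ TangentSpace 𝓘(ℝ, E') z) (F y)
        (mfderiv 𝓘(ℝ, E) 𝓘(ℝ, E') F y (Y y))) x :=
  ContMDiffAt.clm_apply_of_inCoordinates (ContMDiffAt.mfderiv_const (m := ∞) hF (by norm_num))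
    hY hF

theorem mdifferentiableAt_mvfderiv_apply {f : M → E'} {x : M}
    {Y : Π x : M, TangentSpace 𝓘(ℝ, E) x} (hf : CMDiffAt ∞ f x) (hY : MDiffAt (T% Y) x) :
    MDiffAt (fun y ↦ mvfderiv 𝓘(ℝ, E) f y (Y y)) x := by
  have h := (mdifferentiableAt_totalSpace _ _).1 (mdifferentiableAt_mfderiv_apply hf hY)
  have h2 := h.2
  simp only [trivializationAt_model_space_apply] at h2
  exact h2

theorem mfderiv_extChartAt_extend {x y : M} (v : TangentSpace 𝓘(ℝ, E) x)
    (hy : y ∈ (chartAt E x).source) :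
    mfderiv 𝓘(ℝ, E) 𝓘(ℝ, E) (extChartAt 𝓘(ℝ, E) x) y
        ((extend E v : Π y : M, TangentSpace 𝓘(ℝ, E) y) y) =
      (trivializationAt E (TangentSpace 𝓘(ℝ, E) : M → Type _) x ⟨x, v⟩).2 := by
  have hb : y ∈ (trivializationAt E (TangentSpace 𝓘(ℝ, E) : M → Type _) x).baseSet := by
    simpa using hy
  rw [← TangentBundle.continuousLinearMapAt_trivializationAt hy]
  have h := (trivializationAt E (TangentSpace 𝓘(ℝ, E) : M → Type _) x).continuousLinearMapAt_symmL
    (R := ℝ) hb (trivializationAt E (TangentSpace 𝓘(ℝ, E) : M → Type _) x ⟨x, v⟩).2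
  rw [Trivialization.symmL_apply _ hb] at h
  exact h

/-- The chart carries `extend E v` to a fixed direction, so differentiating along it is an ordinary
directional derivative, which can be differentiated once more in `E`. -/
theorem mvfderiv_extend_eventually_eq {f : M → E'} {x : M} (hf : CMDiffAt ∞ f x)
    (v : TangentSpace 𝓘(ℝ, E) x) :
    ∀ᶠ y in nhds x, mvfderiv 𝓘(ℝ, E) f y ((extend E v : Π y : M, TangentSpace 𝓘(ℝ, E) y) y) =
      fderiv ℝ (f ∘ (extChartAt 𝓘(ℝ, E) x).symm) (extChartAt 𝓘(ℝ, E) x y)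
        (trivializationAt E (TangentSpace 𝓘(ℝ, E) : M → Type _) x ⟨x, v⟩).2 := by
  have hf1 : ∀ᶠ y in nhds x, CMDiffAt 1 f y :=
    (contMDiffAt_iff_contMDiffAt_nhds (by simp)).1 (hf.of_le (m := 1) ENat.LEInfty.out)
  filter_upwards [hf1, chart_source_mem_nhds E x] with y hfy hy
  have hy' : y ∈ (extChartAt 𝓘(ℝ, E) x).source := by simpa using hy
  have hχ : MDiffAt (extChartAt 𝓘(ℝ, E) x) y := mdifferentiableAt_extChartAt hy
  have hsymm : MDiffAt (extChartAt 𝓘(ℝ, E) x).symm (extChartAt 𝓘(ℝ, E) x y) := by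
    refine ((contMDiffOn_extChartAt_symm (n := 1) x).contMDiffAt ?_).mdifferentiableAt one_ne_zero
    exact (isOpen_extChartAt_target x).mem_nhds ((extChartAt 𝓘(ℝ, E) x).map_source hy')
  have hh : MDiffAt (f ∘ (extChartAt 𝓘(ℝ, E) x).symm) (extChartAt 𝓘(ℝ, E) x y) := by
    refine MDifferentiableAt.comp (I' := 𝓘(ℝ, E)) _ ?_ hsymm
    rw [(extChartAt 𝓘(ℝ, E) x).left_inv hy']
    exact hfy.mdifferentiableAt one_ne_zero
  have heq : f =ᶠ[nhds y] (f ∘ (extChartAt 𝓘(ℝ, E) x).symm) ∘ extChartAt 𝓘(ℝ, E) x := by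
    filter_upwards [(chartAt E x).open_source.mem_nhds hy] with z hz
    have hz' : z ∈ (extChartAt 𝓘(ℝ, E) x).source := by simpa using hz
    simp only [Function.comp_apply, (extChartAt 𝓘(ℝ, E) x).left_inv hz']
  have h1 : mvfderiv 𝓘(ℝ, E) f y = (mvfderiv 𝓘(ℝ, E) (f ∘ (extChartAt 𝓘(ℝ, E) x).symm)
      (extChartAt 𝓘(ℝ, E) x y)) ∘L mfderiv 𝓘(ℝ, E) 𝓘(ℝ, E) (extChartAt 𝓘(ℝ, E) x) y := by
    rw [mvfderiv_congr_of_eventuallyEq heq]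
    exact mfderiv_comp y hh hχ
  rw [h1, ContinuousLinearMap.comp_apply, mfderiv_extChartAt_extend v hy, mvfderiv_eq_fderiv]
  rfl

theorem contDiffAt_comp_extChartAt_symm {f : M → E'} {x : M} (hf : CMDiffAt ∞ f x) :
    ContDiffAt ℝ ∞ (f ∘ (extChartAt 𝓘(ℝ, E) x).symm) (extChartAt 𝓘(ℝ, E) x x) := by
  rw [← contMDiffAt_iff_contDiffAt]
  refine ContMDiffAt.comp (I' := 𝓘(ℝ, E)) _ ?_ ?_
  · rwa [extChartAt_to_inv]
  · exact (contMDiffOn_extChartAt_symm (n := ∞) x).contMDiffAt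
      ((isOpen_extChartAt_target x).mem_nhds (mem_extChartAt_target x))

/-- The commutator formula `X (Y f) - Y (X f) = [X, Y] f` for vector-valued functions. -/
theorem mvfderiv_mvfderiv_apply_sub [FiniteDimensional ℝ E] {f : M → E'} {x : M}
    {X Y : Π x : M, TangentSpace 𝓘(ℝ, E) x}
    (hf : CMDiffAt ∞ f x) (hX : MDiffAt (T% X) x) (hY : MDiffAt (T% Y) x) :
    mvfderiv 𝓘(ℝ, E) (fun y ↦ mvfderiv 𝓘(ℝ, E) f y (Y y)) x (X x) -
      mvfderiv 𝓘(ℝ, E) (fun y ↦ mvfderiv 𝓘(ℝ, E) f y (X y)) x (Y x) =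
    mvfderiv 𝓘(ℝ, E) f x (mlieBracket 𝓘(ℝ, E) X Y x) := by
  have := FiniteDimensional.complete ℝ E
  -- `D` is the defect of the formula. It is tensorial in `X` by the Leibniz rules, and in `Y` by
  -- antisymmetry.
  let D (X Y : Π x : M, TangentSpace 𝓘(ℝ, E) x) : E' :=
    mvfderiv 𝓘(ℝ, E) (fun y ↦ mvfderiv 𝓘(ℝ, E) f y (Y y)) x (X x) -
      mvfderiv 𝓘(ℝ, E) (fun y ↦ mvfderiv 𝓘(ℝ, E) f y (X y)) x (Y x) -
    mvfderiv 𝓘(ℝ, E) f x (mlieBracket 𝓘(ℝ, E) X Y x)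
  have hswap (X Y : Π x : M, TangentSpace 𝓘(ℝ, E) x) : D X Y = -D Y X := by
    simp only [D]
    rw [mlieBracket_swap_apply, map_neg]
    abel
  have hleft (Y : Π x : M, TangentSpace 𝓘(ℝ, E) x) (hY : MDiffAt (T% Y) x) :
      TensorialAt 𝓘(ℝ, E) E (fun X ↦ D X Y) x :=
    { smul := by
        intro g X hg hX
        simp only [D, Pi.smul_apply', map_smul]
        rw [mvfderiv_fun_smul hg (mdifferentiableAt_mvfderiv_apply hf hX),
          mlieBracket_smul_left hg hX]
        simp
        module
      add := by
        intro X X' hX hX'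
        simp only [D, Pi.add_apply, map_add]
        rw [mvfderiv_fun_add (mdifferentiableAt_mvfderiv_apply hf hX)
          (mdifferentiableAt_mvfderiv_apply hf hX'), mlieBracket_add_left hX hX']
        simp
        module }
  have hright (X : Π x : M, TangentSpace 𝓘(ℝ, E) x) (hX : MDiffAt (T% X) x) :
      TensorialAt 𝓘(ℝ, E) E (fun Y ↦ D X Y) x :=
    { smul := by
        intro g Y hg hY
        rw [hswap, (hleft X hX).smul hg hY, hswap X Y, smul_neg]
      add := by
        intro Y Y' hY hY'
        rw [hswap, (hleft X hX).add hY hY', hswap X Y, hswap X Y']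
        abel }
  suffices h : D X Y = 0 by
    simpa only [D, sub_eq_zero] using h
  -- Tensoriality permits replacing `X` and `Y` by extensions of their values at `x`. Their bracket
  -- vanishes, and what remains is the symmetry of the second derivative in the chart.
  rw [TensorialAt.pointwise₂ hleft hright hX (mdifferentiableAt_extend _ _ (X x)) hY
    (mdifferentiableAt_extend _ _ (Y x)) (by simp) (by simp)]
  have hfs := contDiffAt_comp_extChartAt_symm hf
  have hfd : DifferentiableAt ℝ (fderiv ℝ (f ∘ (extChartAt 𝓘(ℝ, E) x).symm))
      (extChartAt 𝓘(ℝ, E) x x) :=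
    (hfs.fderiv_right (m := 1) (by norm_num; exact ENat.LEInfty.out)).differentiableAt one_ne_zero
  have hd (u v : TangentSpace 𝓘(ℝ, E) x) :
      mvfderiv 𝓘(ℝ, E) (fun y ↦ mvfderiv 𝓘(ℝ, E) f y
        ((extend E v : Π y : M, TangentSpace 𝓘(ℝ, E) y) y)) x
        ((extend E u : Π y : M, TangentSpace 𝓘(ℝ, E) y) x) =
        fderiv ℝ (fderiv ℝ (f ∘ (extChartAt 𝓘(ℝ, E) x).symm)) (extChartAt 𝓘(ℝ, E) x x)
          (trivializationAt E (TangentSpace 𝓘(ℝ, E) : M → Type _) x ⟨x, u⟩).2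
          (trivializationAt E (TangentSpace 𝓘(ℝ, E) : M → Type _) x ⟨x, v⟩).2 := by
    rw [mvfderiv_congr_of_eventuallyEq (mvfderiv_extend_eventually_eq hf v)]
    have hG : DifferentiableAt ℝ (fun z ↦ fderiv ℝ (f ∘ (extChartAt 𝓘(ℝ, E) x).symm) z
        (trivializationAt E (TangentSpace 𝓘(ℝ, E) : M → Type _) x ⟨x, v⟩).2)
        (extChartAt 𝓘(ℝ, E) x x) := hfd.clm_apply (differentiableAt_const _)
    have h1 := mfderiv_comp_apply_of_eq x hG.mdifferentiableAt
      (mdifferentiableAt_extChartAt (I := 𝓘(ℝ, E)) (mem_chart_source E x)) rfl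
      ((extend E u : Π y : M, TangentSpace 𝓘(ℝ, E) y) x)
    refine Eq.trans (b := mvfderiv 𝓘(ℝ, E) (fun z ↦ fderiv ℝ (f ∘ (extChartAt 𝓘(ℝ, E) x).symm) z
        (trivializationAt E (TangentSpace 𝓘(ℝ, E) : M → Type _) x ⟨x, v⟩).2)
        (extChartAt 𝓘(ℝ, E) x x) (mfderiv 𝓘(ℝ, E) 𝓘(ℝ, E) (extChartAt 𝓘(ℝ, E) x) x _)) h1 ?_
    rw [mfderiv_extChartAt_extend u (mem_chart_source E x), mvfderiv_eq_fderiv,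
      fderiv_clm_apply hfd (differentiableAt_const _)]
    simp
    rfl
  simp only [D]
  rw [mlieBracket_extend_extend, hd, hd, map_zero, sub_zero, sub_eq_zero]
  exact (hfs.isSymmSndFDerivAt
    (by rw [minSmoothness_of_isRCLikeNormedField]; exact ENat.LEInfty.out)).eq _ _

end SecondDerivative

/-! ### The metric in a trivialization -/

section MetricCoordinates

variable {E : Type*} [NormedAddCommGroup E] [NormedSpace ℝ E]
  {M : Type*} [TopologicalSpace M] [ChartedSpace E M] [IsManifold 𝓘(ℝ, E) ∞ M]

/-- The vector field with constant coordinates `w` in the trivialization at `x`. -/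
noncomputable def trivField (x : M) (w : E) : Π y : M, TangentSpace 𝓘(ℝ, E) y :=
  fun y ↦ (trivializationAt E (TangentSpace 𝓘(ℝ, E) : M → Type _) x).symm y w

/-- The coordinates of a tangent vector in the trivialization at `x`. -/
noncomputable def trivCoord (x : M) {y : M} (v : TangentSpace 𝓘(ℝ, E) y) : E :=
  (trivializationAt E (TangentSpace 𝓘(ℝ, E) : M → Type _) x ⟨y, v⟩).2

theorem extend_eq_trivField {x : M} (v : TangentSpace 𝓘(ℝ, E) x) :
    (extend E v : Π y : M, TangentSpace 𝓘(ℝ, E) y) = trivField x (trivCoord x v) := rfl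

theorem mem_baseSet_iff {x y : M} :
    y ∈ (trivializationAt E (TangentSpace 𝓘(ℝ, E) : M → Type _) x).baseSet ↔
      y ∈ (chartAt E x).source := by
  rw [TangentBundle.trivializationAt_baseSet]

theorem trivCoord_trivField {x y : M} (hy : y ∈ (chartAt E x).source) (w : E) :
    trivCoord x (trivField x w y) = w := by
  unfold trivCoord trivField
  rw [Trivialization.apply_mk_symm _ (mem_baseSet_iff.2 hy)]

theorem trivField_trivCoord {x y : M} (hy : y ∈ (chartAt E x).source)
    (v : TangentSpace 𝓘(ℝ, E) y) : trivField x (trivCoord x v) y = v := by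
  unfold trivCoord trivField
  exact Trivialization.symm_apply_apply_mk _ (mem_baseSet_iff.2 hy) v

theorem trivCoord_eq_continuousLinearMapAt {x y : M} (hy : y ∈ (chartAt E x).source)
    (v : TangentSpace 𝓘(ℝ, E) y) : trivCoord x v =
      (trivializationAt E (TangentSpace 𝓘(ℝ, E) : M → Type _) x).continuousLinearMapAt ℝ y v :=
  (congrFun (Trivialization.coe_linearMapAt_of_mem (R := ℝ)
    (trivializationAt E (TangentSpace 𝓘(ℝ, E) : M → Type _) x) (mem_baseSet_iff.2 hy)) v).symm

theorem trivField_sum {x y : M} (hy : y ∈ (chartAt E x).source) {ι : Type*} (s : Finset ι)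
    (c : ι → ℝ) (w : ι → E) :
    trivField x (∑ i ∈ s, c i • w i) y = ∑ i ∈ s, c i • trivField x (w i) y := by
  unfold trivField
  have hb := mem_baseSet_iff.2 hy
  simp only [← Trivialization.symmL_apply (R := ℝ) _ hb, map_sum, map_smul]

theorem contMDiffAt_trivField (x : M) (w : E) : CMDiffAt ∞ (T% (trivField x w)) x := by
  rw [← trivCoord_trivField (mem_chart_source E x) w, ← extend_eq_trivField]
  exact (contMDiffOn_extend _).contMDiffAt
    ((chartAt E x).open_source.mem_nhds (mem_chart_source E x))

variable [FiniteDimensional ℝ E]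
  [RiemannianBundle (fun x : M ↦ TangentSpace 𝓘(ℝ, E) x)]

/-- The metric in the trivialization at `x`. -/
noncomputable def metricCoord (x y : M) : E →L[ℝ] E →L[ℝ] ℝ :=
  ∑ i, ∑ j, ⟪trivField x (Module.finBasis ℝ E i) y, trivField x (Module.finBasis ℝ E j) y⟫_ℝ •
    (LinearMap.toContinuousLinearMap ((Module.finBasis ℝ E).coord i)).smulRight
      (LinearMap.toContinuousLinearMap ((Module.finBasis ℝ E).coord j))

theorem metricCoord_apply {x y : M} (hy : y ∈ (chartAt E x).source) (u w : E) :
    metricCoord x y u w = ⟪trivField x u y, trivField x w y⟫_ℝ := by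
  conv_rhs => rw [← (Module.finBasis ℝ E).sum_repr u, ← (Module.finBasis ℝ E).sum_repr w]
  rw [trivField_sum hy, trivField_sum hy]
  simp only [metricCoord, sum_apply, smul_apply, ContinuousLinearMap.smulRight_apply,
    LinearMap.coe_toContinuousLinearMap', Module.Basis.coord_apply]
  rw [sum_inner]
  refine Finset.sum_congr rfl fun i _ ↦ ?_
  rw [inner_sum]
  refine Finset.sum_congr rfl fun j _ ↦ ?_
  rw [inner_smul_left, inner_smul_right, conj_trivial, smul_eq_mul, smul_eq_mul]
  ring

variable [IsContMDiffRiemannianBundle 𝓘(ℝ, E) ∞ E (fun x : M ↦ TangentSpace 𝓘(ℝ, E) x)]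

theorem contMDiffAt_metricCoord (x : M) : CMDiffAt ∞ (metricCoord x : M → E →L[ℝ] E →L[ℝ] ℝ) x := by
  unfold metricCoord
  refine ContMDiffAt.sum fun i _ ↦ ContMDiffAt.sum fun j _ ↦ ?_
  exact ContMDiffAt.smul (ContMDiffAt.inner_bundle
      (E := fun x : M ↦ TangentSpace 𝓘(ℝ, E) x) (contMDiffAt_trivField _ _)
      (contMDiffAt_trivField _ _)) contMDiffAt_const

theorem leviCivita_sub {X Y : Π x : M, TangentSpace 𝓘(ℝ, E) x} {x : M}
    (hX : MDiffAt (T% X) x) (hY : MDiffAt (T% Y) x) :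
    leviCivita E M Y x (X x) - leviCivita E M X x (Y x) = mlieBracket 𝓘(ℝ, E) X Y x :=
  (CovariantDerivative.torsion_eq_zero_iff _).1 leviCivita_torsion hX hY

theorem leviCivita_metric_apply {Y Z : Π x : M, TangentSpace 𝓘(ℝ, E) x} {p : M}
    (hY : MDiffAt (T% Y) p) (hZ : MDiffAt (T% Z) p)
    (v : TangentSpace 𝓘(ℝ, E) p) :
    mvfderiv 𝓘(ℝ, E) (fun y ↦ ⟪Y y, Z y⟫_ℝ) p v =
      ⟪leviCivita E M Y p v, Z p⟫_ℝ + ⟪Y p, leviCivita E M Z p v⟫_ℝ := by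
  have h := leviCivita_metric (mdifferentiableAt_extend 𝓘(ℝ, E) E v) hY hZ
  rwa [extend_apply_self] at h

end MetricCoordinates

/-! ### Product rule for operator-valued functions -/

section ProductRule

variable {E : Type*} [NormedAddCommGroup E] [NormedSpace ℝ E]
  {M : Type*} [TopologicalSpace M] [ChartedSpace E M]
  {G : Type*} [NormedAddCommGroup G] [NormedSpace ℝ G]
  {G' : Type*} [NormedAddCommGroup G'] [NormedSpace ℝ G']

theorem mvfderiv_clm_apply {L : M → G →L[ℝ] G'} {u : M → G} {p : M}
    (hL : MDiffAt L p) (hu : MDiffAt u p) (v : TangentSpace 𝓘(ℝ, E) p) :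
    mvfderiv 𝓘(ℝ, E) (fun q ↦ L q (u q)) p v =
      mvfderiv 𝓘(ℝ, E) L p v (u p) + L p (mvfderiv 𝓘(ℝ, E) u p v) := by
  rw [(hL.clm_apply hu).mvfderiv, hL.mvfderiv, hu.mvfderiv]
  have h1 := hL.differentiableWithinAt_writtenInExtChartAt
  have h2 := hu.differentiableWithinAt_writtenInExtChartAt
  have h := fderivWithin_clm_apply ?_ h1 h2
  · have := congrArg (fun A : E →L[ℝ] G' ↦ A v) h
    have hLp : writtenInExtChartAt 𝓘(ℝ, E) 𝓘(ℝ, G →L[ℝ] G') p L (extChartAt 𝓘(ℝ, E) p p) = L p := by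
      simp [writtenInExtChartAt]
      rfl
    have hup : writtenInExtChartAt 𝓘(ℝ, E) 𝓘(ℝ, G) p u (extChartAt 𝓘(ℝ, E) p p) = u p := by
      simp [writtenInExtChartAt]
      rfl
    rw [hLp, hup] at this
    rw [add_comm]
    exact this
  · exact 𝓘(ℝ, E).uniqueDiffOn _ (by simp)

end ProductRule

/-! ### The pullback connection: metric and torsion-free -/

section Pullback

set_option linter.unusedSectionVars false

variable {E : Type*} [NormedAddCommGroup E] [NormedSpace ℝ E] [FiniteDimensional ℝ E]
  {M : Type*} [TopologicalSpace M] [ChartedSpace E M] [IsManifold 𝓘(ℝ, E) ∞ M]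
  {E' : Type*} [NormedAddCommGroup E'] [NormedSpace ℝ E'] [FiniteDimensional ℝ E']
  {N : Type*} [TopologicalSpace N] [ChartedSpace E' N] [IsManifold 𝓘(ℝ, E') ∞ N]
  [RiemannianBundle (fun x : N ↦ TangentSpace 𝓘(ℝ, E') x)]
  [IsContMDiffRiemannianBundle 𝓘(ℝ, E') ∞ E' (fun x : N ↦ TangentSpace 𝓘(ℝ, E') x)]
  {F : M → N} {p : M}

theorem pullbackNabla_eq (s : Π p : M, TangentSpace 𝓘(ℝ, E') (F p)) (v : TangentSpace 𝓘(ℝ, E) p) :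
    pullbackNabla F s p v =
      trivField (F p) (mvfderiv 𝓘(ℝ, E) (fun q ↦ trivCoord (F p) (s q)) p v) (F p) +
        leviCivita E' N (trivField (F p) (trivCoord (F p) (s p))) (F p)
          (mfderiv 𝓘(ℝ, E) 𝓘(ℝ, E') F p v) := rfl

/-- The pullback of the Levi-Civita connection is compatible with the metric. -/
theorem mvfderiv_inner_pullback {s t : Π p : M, TangentSpace 𝓘(ℝ, E') (F p)}
    (hF : MDiffAt F p)
    (hs : MDifferentiableAt 𝓘(ℝ, E) (𝓘(ℝ, E').prod 𝓘(ℝ, E'))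
      (fun y ↦ TotalSpace.mk' E' (E := fun z : N ↦ TangentSpace 𝓘(ℝ, E') z) (F y) (s y)) p)
    (ht : MDifferentiableAt 𝓘(ℝ, E) (𝓘(ℝ, E').prod 𝓘(ℝ, E'))
      (fun y ↦ TotalSpace.mk' E' (E := fun z : N ↦ TangentSpace 𝓘(ℝ, E') z) (F y) (t y)) p)
    (v : TangentSpace 𝓘(ℝ, E) p) :
    mvfderiv 𝓘(ℝ, E) (fun q ↦ ⟪s q, t q⟫_ℝ) p v =
      ⟪pullbackNabla F s p v, t p⟫_ℝ + ⟪s p, pullbackNabla F t p v⟫_ℝ := by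
  have hσ : MDiffAt (fun q ↦ trivCoord (F p) (s q)) p := ((mdifferentiableAt_totalSpace _ _).1 hs).2
  have hτ : MDiffAt (fun q ↦ trivCoord (F p) (t q)) p := ((mdifferentiableAt_totalSpace _ _).1 ht).2
  have hp := mem_chart_source E' (F p)
  have hH : MDiffAt (metricCoord (F p) : N → E' →L[ℝ] E' →L[ℝ] ℝ) (F p) :=
    (contMDiffAt_metricCoord (F p)).mdifferentiableAt (by simp)
  have hHF : MDifferentiableAt 𝓘(ℝ, E) 𝓘(ℝ, E' →L[ℝ] E' →L[ℝ] ℝ)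
      (fun q ↦ metricCoord (F p) (F q)) p := hH.comp p hF
  have heq : (fun q ↦ ⟪s q, t q⟫_ℝ) =ᶠ[nhds p]
      (fun q ↦ metricCoord (F p) (F q) (trivCoord (F p) (s q)) (trivCoord (F p) (t q))) := by
    filter_upwards [hF.continuousAt.preimage_mem_nhds
      ((chartAt E' (F p)).open_source.mem_nhds hp)] with q hq
    rw [metricCoord_apply hq, trivField_trivCoord hq, trivField_trivCoord hq]
  rw [mvfderiv_congr_of_eventuallyEq heq, mvfderiv_clm_apply (hHF.clm_apply hσ) hτ,
    mvfderiv_clm_apply hHF hσ]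
  have hcomp : mvfderiv 𝓘(ℝ, E) (fun q ↦ metricCoord (F p) (F q)) p v =
      mvfderiv 𝓘(ℝ, E') (metricCoord (F p)) (F p) (mfderiv 𝓘(ℝ, E) 𝓘(ℝ, E') F p v) :=
    mfderiv_comp_apply p hH hF v
  -- Metric compatibility on `N` for fields with constant coordinates: the derivative of the metric
  -- coefficients yields exactly the connection terms of the two pullback derivatives.
  have hmet (a b : E') (w : TangentSpace 𝓘(ℝ, E') (F p)) :
      mvfderiv 𝓘(ℝ, E') (metricCoord (F p)) (F p) w a b =
        ⟪leviCivita E' N (trivField (F p) a) (F p) w, trivField (F p) b (F p)⟫_ℝ +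
        ⟪trivField (F p) a (F p), leviCivita E' N (trivField (F p) b) (F p) w⟫_ℝ := by
    have ha : MDiffAt (T% (trivField (F p) a)) (F p) :=
      (contMDiffAt_trivField (F p) a).mdifferentiableAt (by simp)
    have hb : MDiffAt (T% (trivField (F p) b)) (F p) :=
      (contMDiffAt_trivField (F p) b).mdifferentiableAt (by simp)
    have h1 := leviCivita_metric (mdifferentiableAt_extend 𝓘(ℝ, E') E' w) ha hb
    rw [extend_apply_self] at h1
    rw [← h1]
    have heq' : (fun y ↦ ⟪trivField (F p) a y, trivField (F p) b y⟫_ℝ) =ᶠ[nhds (F p)]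
        (fun y ↦ metricCoord (F p) y a b) := by
      filter_upwards [(chartAt E' (F p)).open_source.mem_nhds hp] with y hy
      rw [metricCoord_apply hy]
    rw [mvfderiv_congr_of_eventuallyEq heq',
      mvfderiv_clm_apply (hH.clm_apply mdifferentiableAt_const) mdifferentiableAt_const,
      mvfderiv_clm_apply hH mdifferentiableAt_const]
    simp [mvfderiv_const]
  rw [hcomp, add_apply, hmet, metricCoord_apply hp, metricCoord_apply hp,
    pullbackNabla_eq, pullbackNabla_eq, inner_add_left, inner_add_right,
    trivField_trivCoord hp, trivField_trivCoord hp]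
  ring

/-- The chain rule for the chart composed with `F`. It turns coordinates of `F_*` into first
derivatives of a vector-valued function, to which the commutator formula applies. -/
theorem trivCoord_mfderiv_eventually_eq (hF : CMDiffAt ∞ F p) :
    ∀ᶠ q in nhds p, ∀ u : TangentSpace 𝓘(ℝ, E) q,
      trivCoord (F p) (mfderiv 𝓘(ℝ, E) 𝓘(ℝ, E') F q u) =
      mvfderiv 𝓘(ℝ, E) (extChartAt 𝓘(ℝ, E') (F p) ∘ F) q u := by
  have hF1 : ∀ᶠ q in nhds p, CMDiffAt 1 F q :=
    (contMDiffAt_iff_contMDiffAt_nhds (by simp)).1 (hF.of_le (m := 1) ENat.LEInfty.out)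
  filter_upwards [hF1, hF.continuousAt.preimage_mem_nhds
    ((chartAt E' (F p)).open_source.mem_nhds (mem_chart_source E' (F p)))] with q hFq hq u
  have h1 : trivCoord (F p) (mfderiv 𝓘(ℝ, E) 𝓘(ℝ, E') F q u) =
      mfderiv 𝓘(ℝ, E') 𝓘(ℝ, E') (extChartAt 𝓘(ℝ, E') (F p)) (F q)
        (mfderiv 𝓘(ℝ, E) 𝓘(ℝ, E') F q u) := by
    rw [← TangentBundle.continuousLinearMapAt_trivializationAt hq]
    exact trivCoord_eq_continuousLinearMapAt hq _
  rw [h1]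
  exact (mfderiv_comp_apply q (mdifferentiableAt_extChartAt hq)
    (hFq.mdifferentiableAt one_ne_zero) u).symm

/-- The pullback of the Levi-Civita connection is torsion-free. -/
theorem pullbackNabla_mfderiv_sub {X Y : Π x : M, TangentSpace 𝓘(ℝ, E) x}
    (hF : CMDiffAt ∞ F p) (hX : MDiffAt (T% X) p) (hY : MDiffAt (T% Y) p) :
    pullbackNabla F (fun q ↦ mfderiv 𝓘(ℝ, E) 𝓘(ℝ, E') F q (Y q)) p (X p) -
      pullbackNabla F (fun q ↦ mfderiv 𝓘(ℝ, E) 𝓘(ℝ, E') F q (X q)) p (Y p) =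
    mfderiv 𝓘(ℝ, E) 𝓘(ℝ, E') F p (mlieBracket 𝓘(ℝ, E) X Y p) := by
  have hχF : CMDiffAt ∞ (extChartAt 𝓘(ℝ, E') (F p) ∘ F) p := contMDiffAt_extChartAt.comp p hF
  have hev := trivCoord_mfderiv_eventually_eq (p := p) hF
  have hcoord (Z : Π x : M, TangentSpace 𝓘(ℝ, E) x) :
      mvfderiv 𝓘(ℝ, E) (fun q ↦ trivCoord (F p) (mfderiv 𝓘(ℝ, E) 𝓘(ℝ, E') F q (Z q))) p =
      mvfderiv 𝓘(ℝ, E)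
        (fun q ↦ mvfderiv 𝓘(ℝ, E) (extChartAt 𝓘(ℝ, E') (F p) ∘ F) q (Z q)) p :=
    mvfderiv_congr_of_eventuallyEq (hev.mono fun q hq ↦ hq (Z q))
  have hX' := mdifferentiableAt_extend 𝓘(ℝ, E') E' (mfderiv 𝓘(ℝ, E) 𝓘(ℝ, E') F p (X p))
  have hY' := mdifferentiableAt_extend 𝓘(ℝ, E') E' (mfderiv 𝓘(ℝ, E) 𝓘(ℝ, E') F p (Y p))
  have h2 := leviCivita_sub hX' hY'
  have := FiniteDimensional.complete ℝ E'
  -- The extensions commute, so `h2` becomes the symmetry of the Christoffel symbols of `N`, and the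
  -- two connection terms cancel.
  rw [mlieBracket_extend_extend, extend_apply_self, extend_apply_self, extend_eq_trivField,
    extend_eq_trivField] at h2
  have h3 := mvfderiv_mvfderiv_apply_sub hχF hX hY
  have hp := mem_chart_source E' (F p)
  rw [pullbackNabla_eq, pullbackNabla_eq, hcoord, hcoord, add_sub_add_comm, h2, add_zero]
  have hsub (a b : E') : trivField (F p) a (F p) - trivField (F p) b (F p) =
      trivField (F p) (a - b) (F p) := by
    unfold trivField
    simp only [← Trivialization.symmL_apply (R := ℝ) _ (mem_baseSet_iff.2 hp), map_sub]
  rw [hsub, h3, ← hev.self_of_nhds, trivField_trivCoord hp]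

end Pullback

/-! ### Vertical and horizontal projections of a Riemannian submersion -/

section Projections

set_option linter.unusedSectionVars false

variable {E : Type*} [NormedAddCommGroup E] [NormedSpace ℝ E] [FiniteDimensional ℝ E]
  {M : Type*} [TopologicalSpace M] [ChartedSpace E M]
  [RiemannianBundle (fun x : M ↦ TangentSpace 𝓘(ℝ, E) x)]
  {E' : Type*} [NormedAddCommGroup E'] [NormedSpace ℝ E']
  {N : Type*} [TopologicalSpace N] [ChartedSpace E' N]
  {F : M → N} {p : M}

theorem vertField_add_horField (X : Π x : M, TangentSpace 𝓘(ℝ, E) x) (q : M) :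
    vertField E E' F X q + horField E E' F X q = X q :=
  (vertical E E' F q).starProjection_add_starProjection_orthogonal (X q)

theorem vertField_mem (X : Π x : M, TangentSpace 𝓘(ℝ, E) x) (q : M) :
    vertField E E' F X q ∈ vertical E E' F q :=
  Submodule.starProjection_apply_mem _ _

theorem horField_mem (X : Π x : M, TangentSpace 𝓘(ℝ, E) x) (q : M) :
    horField E E' F X q ∈ horizontal E E' F q :=
  Submodule.starProjection_apply_mem _ _

theorem inner_vertical_horizontal {u v : TangentSpace 𝓘(ℝ, E) p} (hu : u ∈ vertical E E' F p)
    (hv : v ∈ horizontal E E' F p) : ⟪u, v⟫_ℝ = 0 :=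
  hv u hu

theorem inner_horizontal_vertical {u v : TangentSpace 𝓘(ℝ, E) p} (hu : u ∈ horizontal E E' F p)
    (hv : v ∈ vertical E E' F p) : ⟪u, v⟫_ℝ = 0 := by
  rw [real_inner_comm]
  exact hu v hv

theorem vertField_eq_self {X : Π x : M, TangentSpace 𝓘(ℝ, E) x} {q : M}
    (h : X q ∈ vertical E E' F q) : vertField E E' F X q = X q :=
  Submodule.starProjection_eq_self_iff.2 h

theorem horField_eq_self {X : Π x : M, TangentSpace 𝓘(ℝ, E) x} {q : M}
    (h : X q ∈ horizontal E E' F q) : horField E E' F X q = X q :=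
  Submodule.starProjection_eq_self_iff.2 h

theorem mem_vertical {v : TangentSpace 𝓘(ℝ, E) p} :
    v ∈ vertical E E' F p ↔ mfderiv 𝓘(ℝ, E) 𝓘(ℝ, E') F p v = 0 :=
  LinearMap.mem_ker

theorem mem_vertical_iff_inner {v : TangentSpace 𝓘(ℝ, E) p} :
    v ∈ vertical E E' F p ↔ ∀ u ∈ horizontal E E' F p, ⟪u, v⟫_ℝ = 0 := by
  conv_lhs => rw [← Submodule.orthogonal_orthogonal (vertical E E' F p)]
  exact Submodule.mem_orthogonal _ _

theorem exists_vertical_add_horizontal (E' : Type*) [NormedAddCommGroup E'] [NormedSpace ℝ E']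
    {N : Type*} [TopologicalSpace N] [ChartedSpace E' N] (F : M → N) (v : TangentSpace 𝓘(ℝ, E) p) :
    ∃ a ∈ vertical E E' F p, ∃ b ∈ horizontal E E' F p, a + b = v :=
  ⟨_, Submodule.starProjection_apply_mem _ _, _, Submodule.starProjection_apply_mem _ _,
    (vertical E E' F p).starProjection_add_starProjection_orthogonal v⟩

variable [IsManifold 𝓘(ℝ, E) ∞ M]
  [IsContMDiffRiemannianBundle 𝓘(ℝ, E) ∞ E (fun x : M ↦ TangentSpace 𝓘(ℝ, E) x)]
  [FiniteDimensional ℝ E'] [IsManifold 𝓘(ℝ, E') ∞ N]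
  [RiemannianBundle (fun x : N ↦ TangentSpace 𝓘(ℝ, E') x)]
  [IsContMDiffRiemannianBundle 𝓘(ℝ, E') ∞ E' (fun x : N ↦ TangentSpace 𝓘(ℝ, E') x)]

namespace IsRiemannianSubmersion

variable (hF : IsRiemannianSubmersion E E' F)
include hF

theorem inner_mfderiv_of_horizontal {u v : TangentSpace 𝓘(ℝ, E) p}
    (hu : u ∈ horizontal E E' F p) (hv : v ∈ horizontal E E' F p) :
    ⟪mfderiv 𝓘(ℝ, E) 𝓘(ℝ, E') F p u, mfderiv 𝓘(ℝ, E) 𝓘(ℝ, E') F p v⟫_ℝ = ⟪u, v⟫_ℝ := by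
  rw [real_inner_eq_norm_add_mul_self_sub_norm_mul_self_sub_norm_mul_self_div_two,
    real_inner_eq_norm_add_mul_self_sub_norm_mul_self_sub_norm_mul_self_div_two, ← map_add,
    hF.norm_horizontal p _ hu, hF.norm_horizontal p _ hv,
    hF.norm_horizontal p _ (Submodule.add_mem _ hu hv)]

/-- One horizontal argument suffices: `F_*` kills the vertical part of `u`, and that part is
orthogonal to `v`. -/
theorem inner_mfderiv {u v : TangentSpace 𝓘(ℝ, E) p} (hv : v ∈ horizontal E E' F p) :
    ⟪mfderiv 𝓘(ℝ, E) 𝓘(ℝ, E') F p u, mfderiv 𝓘(ℝ, E) 𝓘(ℝ, E') F p v⟫_ℝ = ⟪u, v⟫_ℝ := by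
  obtain ⟨a, ha, b, hb, rfl⟩ := exists_vertical_add_horizontal E' F u
  rw [map_add, mem_vertical.1 ha, zero_add, inner_add_left, inner_vertical_horizontal ha hv,
    zero_add, hF.inner_mfderiv_of_horizontal hb hv]

/-- The right-hand side involves only `F_*` and the metric of `N`, so it is smooth in `q`; this is
how the horizontal projection is seen to preserve smoothness. -/
theorem inner_horField (X Y : Π x : M, TangentSpace 𝓘(ℝ, E) x) (q : M) :
    ⟪horField E E' F X q, Y q⟫_ℝ =
      ⟪mfderiv 𝓘(ℝ, E) 𝓘(ℝ, E') F q (X q), mfderiv 𝓘(ℝ, E) 𝓘(ℝ, E') F q (Y q)⟫_ℝ := by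
  have hX : mfderiv 𝓘(ℝ, E) 𝓘(ℝ, E') F q (X q) =
      mfderiv 𝓘(ℝ, E) 𝓘(ℝ, E') F q (horField E E' F X q) := by
    conv_lhs => rw [← vertField_add_horField (E' := E') (F := F) X q, map_add,
      mem_vertical.1 (vertField_mem X q), zero_add]
  rw [hX, real_inner_comm, real_inner_comm (mfderiv 𝓘(ℝ, E) 𝓘(ℝ, E') F q (Y q)),
    hF.inner_mfderiv (horField_mem X q)]

theorem contMDiffAt_horField {X : Π x : M, TangentSpace 𝓘(ℝ, E) x}
    (hX : CMDiffAt ∞ (T% X) p) : CMDiffAt ∞ (T% (horField E E' F X)) p := by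
  refine contMDiffAt_of_inner fun Y hY ↦ ?_
  simp only [hF.inner_horField X Y]
  exact ContMDiffAt.inner_bundle (E := fun x : N ↦ TangentSpace 𝓘(ℝ, E') x)
    (contMDiffAt_mfderiv_apply hF.smooth.contMDiffAt hX)
    (contMDiffAt_mfderiv_apply hF.smooth.contMDiffAt hY)

theorem contMDiffAt_vertField {X : Π x : M, TangentSpace 𝓘(ℝ, E) x}
    (hX : CMDiffAt ∞ (T% X) p) : CMDiffAt ∞ (T% (vertField E E' F X)) p := by
  have h : vertField E E' F X = X - horField E E' F X := by
    ext1 q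
    rw [Pi.sub_apply, eq_sub_iff_add_eq, vertField_add_horField]
  rw [h]
  exact hX.sub_section (hF.contMDiffAt_horField hX)

theorem exists_isSmoothField_vertical [T2Space M] {v : TangentSpace 𝓘(ℝ, E) p}
    (hv : v ∈ vertical E E' F p) : ∃ V : Π x : M, TangentSpace 𝓘(ℝ, E) x, IsSmoothField V ∧
      (∀ q, V q ∈ vertical E E' F q) ∧ V p = v := by
  obtain ⟨X, hX, rfl⟩ := exists_isSmoothField_apply_eq v
  exact ⟨vertField E E' F X, fun q ↦ hF.contMDiffAt_vertField (hX.contMDiffAt q), vertField_mem X,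
    vertField_eq_self hv⟩

theorem exists_isSmoothField_horizontal [T2Space M] {v : TangentSpace 𝓘(ℝ, E) p}
    (hv : v ∈ horizontal E E' F p) : ∃ V : Π x : M, TangentSpace 𝓘(ℝ, E) x, IsSmoothField V ∧
      (∀ q, V q ∈ horizontal E E' F q) ∧ V p = v := by
  obtain ⟨X, hX, rfl⟩ := exists_isSmoothField_apply_eq v
  exact ⟨horField E E' F X, fun q ↦ hF.contMDiffAt_horField (hX.contMDiffAt q), horField_mem X,
    horField_eq_self hv⟩

end IsRiemannianSubmersion

end Projections

/-! ### The second fundamental form of a Riemannian submersion -/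

section SecondFundamentalForm

set_option linter.unusedSectionVars false

variable {E : Type*} [NormedAddCommGroup E] [NormedSpace ℝ E] [FiniteDimensional ℝ E]
  {M : Type*} [TopologicalSpace M] [ChartedSpace E M] [IsManifold 𝓘(ℝ, E) ∞ M]
  [RiemannianBundle (fun x : M ↦ TangentSpace 𝓘(ℝ, E) x)]
  [IsContMDiffRiemannianBundle 𝓘(ℝ, E) ∞ E (fun x : M ↦ TangentSpace 𝓘(ℝ, E) x)]
  {E' : Type*} [NormedAddCommGroup E'] [NormedSpace ℝ E'] [FiniteDimensional ℝ E']
  {N : Type*} [TopologicalSpace N] [ChartedSpace E' N] [IsManifold 𝓘(ℝ, E') ∞ N]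
  [RiemannianBundle (fun x : N ↦ TangentSpace 𝓘(ℝ, E') x)]
  [IsContMDiffRiemannianBundle 𝓘(ℝ, E') ∞ E' (fun x : N ↦ TangentSpace 𝓘(ℝ, E') x)]
  {F : M → N} {p : M} {X X' Y Y' : Π x : M, TangentSpace 𝓘(ℝ, E) x}

/-- Both connections are torsion-free, so the two antisymmetrized terms both equal `F_*[X, Y]`. -/
theorem secondFundForm_comm (hF : CMDiffAt ∞ F p) (hX : MDiffAt (T% X) p)
    (hY : MDiffAt (T% Y) p) :
    secondFundForm E E' F X Y p = secondFundForm E E' F Y X p := by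
  rw [← sub_eq_zero]
  have h1 := pullbackNabla_mfderiv_sub hF hX hY
  have h2 := congrArg (mfderiv 𝓘(ℝ, E) 𝓘(ℝ, E') F p) (leviCivita_sub hX hY)
  rw [map_sub] at h2
  unfold secondFundForm
  rw [sub_sub_sub_comm, h1, h2, sub_self]

theorem pullbackNabla_add (s : Π p : M, TangentSpace 𝓘(ℝ, E') (F p))
    (u v : TangentSpace 𝓘(ℝ, E) p) :
    pullbackNabla F s p (u + v) = pullbackNabla F s p u + pullbackNabla F s p v := by
  have hb := mem_baseSet_iff.2 (mem_chart_source E' (F p))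
  unfold pullbackNabla
  simp only [← Trivialization.symmL_apply (R := ℝ) _ hb, map_add]
  abel

theorem pullbackNabla_smul (s : Π p : M, TangentSpace 𝓘(ℝ, E') (F p))
    (c : ℝ) (v : TangentSpace 𝓘(ℝ, E) p) :
    pullbackNabla F s p (c • v) = c • pullbackNabla F s p v := by
  have hb := mem_baseSet_iff.2 (mem_chart_source E' (F p))
  unfold pullbackNabla
  simp only [← Trivialization.symmL_apply (R := ℝ) _ hb, map_smul, smul_add]

/-- Pointwise dependence on the first argument is visible in the formula; symmetry transfers it to
the second. -/
theorem secondFundForm_congr (hF : CMDiffAt ∞ F p)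
    (hX' : MDiffAt (T% X') p) (hY : MDiffAt (T% Y) p) (hY' : MDiffAt (T% Y') p)
    (hXX' : X p = X' p) (hYY' : Y p = Y' p) :
    secondFundForm E E' F X Y p = secondFundForm E E' F X' Y' p := by
  have h {X X' Y : Π x : M, TangentSpace 𝓘(ℝ, E) x} (h : X p = X' p) :
      secondFundForm E E' F X Y p = secondFundForm E E' F X' Y p := by
    unfold secondFundForm
    rw [h]
  rw [h hXX', secondFundForm_comm hF hX' hY, h hYY', secondFundForm_comm hF hY' hX']

/-- The second fundamental form of a smooth map at a point, as a bilinear map. -/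
noncomputable def secondFundFormAt (hF : CMDiffAt ∞ F p) :
    TangentSpace 𝓘(ℝ, E) p →ₗ[ℝ] TangentSpace 𝓘(ℝ, E) p →ₗ[ℝ] TangentSpace 𝓘(ℝ, E') (F p) :=
  have hadd (u u' v : TangentSpace 𝓘(ℝ, E) p) :
      secondFundForm E E' F (extend E (u + u')) (extend E v) p =
      secondFundForm E E' F (extend E u) (extend E v) p +
        secondFundForm E E' F (extend E u') (extend E v) p := by
    simp only [secondFundForm, extend_apply_self, pullbackNabla_add, map_add]
    abel
  have hsmul (c : ℝ) (u v : TangentSpace 𝓘(ℝ, E) p) :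
      secondFundForm E E' F (extend E (c • u)) (extend E v) p =
      c • secondFundForm E E' F (extend E u) (extend E v) p := by
    simp only [secondFundForm, extend_apply_self, pullbackNabla_smul, map_smul, smul_sub]
  have hcomm (u v : TangentSpace 𝓘(ℝ, E) p) :
      secondFundForm E E' F (extend E u) (extend E v) p =
      secondFundForm E E' F (extend E v) (extend E u) p :=
    secondFundForm_comm hF (mdifferentiableAt_extend 𝓘(ℝ, E) E u)
      (mdifferentiableAt_extend 𝓘(ℝ, E) E v)
  LinearMap.mk₂ ℝ (fun u v ↦ secondFundForm E E' F (extend E u) (extend E v) p) hadd hsmul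
    (fun u v v' ↦ by rw [hcomm, hadd, hcomm u, hcomm u])
    (fun c u v ↦ by rw [hcomm, hsmul, hcomm u])

theorem secondFundFormAt_apply (hF : CMDiffAt ∞ F p) (hX : MDiffAt (T% X) p)
    (hY : MDiffAt (T% Y) p) :
    secondFundFormAt hF (X p) (Y p) = secondFundForm E E' F X Y p :=
  secondFundForm_congr hF hX
    (mdifferentiableAt_extend 𝓘(ℝ, E) E _) hY (extend_apply_self E _) (extend_apply_self E _)

theorem secondFundFormAt_comm (hF : CMDiffAt ∞ F p) (u v : TangentSpace 𝓘(ℝ, E) p) :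
    secondFundFormAt hF u v = secondFundFormAt hF v u :=
  secondFundForm_comm hF (mdifferentiableAt_extend 𝓘(ℝ, E) E u)
      (mdifferentiableAt_extend 𝓘(ℝ, E) E v)

theorem tension_eq_sum (hF : CMDiffAt ∞ F p) :
    tension E E' F p = ∑ i, secondFundFormAt hF
      (stdOrthonormalBasis ℝ (TangentSpace 𝓘(ℝ, E) p) i)
      (stdOrthonormalBasis ℝ (TangentSpace 𝓘(ℝ, E) p) i) := rfl

theorem trivField_zero {x y : N} (hy : y ∈ (chartAt E' x).source) :
    trivField x (0 : E') y = 0 := by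
  unfold trivField
  rw [← Trivialization.symmL_apply (R := ℝ) _ (mem_baseSet_iff.2 hy), map_zero]

theorem leviCivita_trivField_zero (x : N) : leviCivita E' N (trivField x 0) x = 0 := by
  have h : leviCivita E' N (trivField x 0) x = leviCivita E' N 0 x :=
    (leviCivita E' N).isCovariantDerivativeOnUniv.congr_of_eventuallyEq
      ((contMDiffAt_trivField x 0).mdifferentiableAt (by simp))
      (mdifferentiableAt_zeroSection ..) Filter.univ_mem
      (Filter.mem_of_superset ((chartAt E' x).open_source.mem_nhds (mem_chart_source E' x))
        fun y hy ↦ trivField_zero hy)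
  rw [h, CovariantDerivative.zero]
  rfl

theorem pullbackNabla_zero (hF : ContinuousAt F p) (v : TangentSpace 𝓘(ℝ, E) p) :
    pullbackNabla F (fun q ↦ (0 : TangentSpace 𝓘(ℝ, E') (F q))) p v = 0 := by
  have hz {y : N} (hy : y ∈ (chartAt E' (F p)).source) :
      trivCoord (F p) (0 : TangentSpace 𝓘(ℝ, E') y) = 0 := by
    rw [trivCoord_eq_continuousLinearMapAt hy, map_zero]
  have heq : (fun q ↦ trivCoord (F p) (0 : TangentSpace 𝓘(ℝ, E') (F q))) =ᶠ[nhds p]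
      (fun _ ↦ (0 : E')) := by
    filter_upwards [hF.preimage_mem_nhds ((chartAt E' (F p)).open_source.mem_nhds
      (mem_chart_source E' (F p)))] with q hq using hz hq
  rw [pullbackNabla_eq, mvfderiv_congr_of_eventuallyEq heq, mvfderiv_const,
    hz (mem_chart_source E' (F p)), leviCivita_trivField_zero]
  simp only [zero_apply, add_zero]
  exact trivField_zero (mem_chart_source E' (F p))

theorem secondFundForm_of_vertical (hF : ContinuousAt F p) (X : Π x : M, TangentSpace 𝓘(ℝ, E) x)
    (hY : ∀ q, Y q ∈ vertical E E' F q) :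
    secondFundForm E E' F X Y p =
      -mfderiv 𝓘(ℝ, E) 𝓘(ℝ, E') F p (leviCivita E M Y p (X p)) := by
  unfold secondFundForm
  simp only [mem_vertical.1 (hY _)]
  rw [pullbackNabla_zero hF, zero_sub]

namespace IsRiemannianSubmersion

variable (hF : IsRiemannianSubmersion E E' F)
include hF

/-- Differentiate `g_N(F_*X, F_*Y) = g_M(X, Y)` along `Z`, using metric compatibility on both sides,
and subtract. -/
theorem inner_secondFundForm_add {Z : Π x : M, TangentSpace 𝓘(ℝ, E) x}
    (hZ : MDiffAt (T% Z) p) (hX : MDiffAt (T% X) p) (hY : MDiffAt (T% Y) p)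
    (hXh : ∀ q, X q ∈ horizontal E E' F q) (hYh : ∀ q, Y q ∈ horizontal E E' F q) :
    ⟪secondFundForm E E' F Z X p, mfderiv 𝓘(ℝ, E) 𝓘(ℝ, E') F p (Y p)⟫_ℝ +
      ⟪secondFundForm E E' F Z Y p, mfderiv 𝓘(ℝ, E) 𝓘(ℝ, E') F p (X p)⟫_ℝ = 0 := by
  have hs : CMDiffAt ∞ F p := hF.smooth.contMDiffAt
  have h1 := mvfderiv_inner_pullback (hs.mdifferentiableAt (by simp))
    (mdifferentiableAt_mfderiv_apply hs hX) (mdifferentiableAt_mfderiv_apply hs hY) (Z p)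
  simp only [hF.inner_mfderiv (hYh _)] at h1
  rw [leviCivita_metric hZ hX hY] at h1
  have h2 := hF.inner_mfderiv (u := leviCivita E M X p (Z p)) (hYh p)
  have h3 := hF.inner_mfderiv (u := leviCivita E M Y p (Z p)) (hXh p)
  unfold secondFundForm
  rw [inner_sub_left, inner_sub_left, h2, h3]
  rw [real_inner_comm _ (X p), real_inner_comm _ (mfderiv 𝓘(ℝ, E) 𝓘(ℝ, E') F p (X p))] at h1
  linarith

/-- The trilinear form `g_N((∇F_*)(x, y), F_*z)` on horizontal vectors is symmetric in `x, y` and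
skew in `y, z`, hence zero. By maximal rank the vectors `F_*z` with `z` horizontal exhaust the
tangent space of `N`. -/
theorem secondFundFormAt_of_horizontal [T2Space M] {u v : TangentSpace 𝓘(ℝ, E) p}
    (hu : u ∈ horizontal E E' F p) (hv : v ∈ horizontal E E' F p) :
    secondFundFormAt (hF.smooth.contMDiffAt (x := p)) u v = 0 := by
  have hskew {x y z : TangentSpace 𝓘(ℝ, E) p} (hx : x ∈ horizontal E E' F p)
      (hy : y ∈ horizontal E E' F p) :
      ⟪secondFundFormAt (hF.smooth.contMDiffAt (x := p)) z x,
          mfderiv 𝓘(ℝ, E) 𝓘(ℝ, E') F p y⟫_ℝ +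
        ⟪secondFundFormAt (hF.smooth.contMDiffAt (x := p)) z y,
          mfderiv 𝓘(ℝ, E) 𝓘(ℝ, E') F p x⟫_ℝ = 0 := by
    obtain ⟨X, hX, hXh, rfl⟩ := hF.exists_isSmoothField_horizontal hx
    obtain ⟨Y, hY, hYh, rfl⟩ := hF.exists_isSmoothField_horizontal hy
    obtain ⟨Z, hZ, rfl⟩ := exists_isSmoothField_apply_eq z
    rw [secondFundFormAt_apply _ (hZ.mdifferentiableAt p) (hX.mdifferentiableAt p),
      secondFundFormAt_apply _ (hZ.mdifferentiableAt p) (hY.mdifferentiableAt p)]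
    exact hF.inner_secondFundForm_add (hZ.mdifferentiableAt p) (hX.mdifferentiableAt p)
      (hY.mdifferentiableAt p) hXh hYh
  have key {x y z : TangentSpace 𝓘(ℝ, E) p} (hx : x ∈ horizontal E E' F p)
      (hy : y ∈ horizontal E E' F p) (hz : z ∈ horizontal E E' F p) :
      ⟪secondFundFormAt (hF.smooth.contMDiffAt (x := p)) x y,
        mfderiv 𝓘(ℝ, E) 𝓘(ℝ, E') F p z⟫_ℝ = 0 := by
    have h1 := hskew (z := x) hy hz
    have h2 := hskew (z := y) hz hx
    have h3 := hskew (z := z) hx hy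
    rw [secondFundFormAt_comm _ y x] at h2
    rw [secondFundFormAt_comm _ z x, secondFundFormAt_comm _ z y] at h3
    linarith
  refine ext_inner_right ℝ fun w ↦ ?_
  obtain ⟨z, rfl⟩ := hF.maximal_rank p w
  obtain ⟨a, ha, b, hb, rfl⟩ := exists_vertical_add_horizontal E' F z
  rw [map_add, mem_vertical.1 ha, zero_add, key hu hv hb, inner_zero_left]

end IsRiemannianSubmersion

end SecondFundamentalForm

/-! ### Pointwise algebra behind `∇φ = 0` -/

section Algebra

/-- The algebra behind the vanishing of `∇φ` on a cosymplectic manifold: `a x y z` stands for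
`g((∇_x φ) y, z)`. -/
theorem eq_zero_of_skew_of_cyclic {V : Type*} [AddCommGroup V] [Module ℝ V] {φ : V → V}
    {η : V → ℝ} {ξ : V} {a : V → V → V → ℝ} (hφ : ∀ x, φ (φ x) = -x + η x • ξ)
    (hadd : ∀ x x' y z, a (x + x') y z = a x y z + a x' y z)
    (hsmul : ∀ (c : ℝ) x y z, a (c • x) y z = c * a x y z)
    (hskew : ∀ x y z, a x y z = -a x z y)
    (hcyc : ∀ x y z, a x y z + a y z x + a z x y = 0)
    (hnormal : ∀ x y z, a (φ x) y z - a (φ y) x z - a y x (φ z) + a x y (φ z) = 0)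
    (hξ : ∀ z, a ξ ξ z = 0) (x y z : V) : a x y z = 0 := by
  -- `hcyc` at `x, y, φ z`, with skewness, turns the last two terms of `hnormal` into `-a (φ z) x
  -- y`.
  have h1 (x y z : V) : a (φ x) y z + a (φ y) z x = a (φ z) x y := by
    linarith [hnormal x y z, hcyc x y (φ z), hskew y x (φ z), hskew (φ y) x z]
  -- By `h1` and its cyclic shifts, any two of three numbers add up to the third, so all three are
  -- zero.
  have h2 (x y z : V) : a (φ x) y z = 0 := by
    linarith [h1 x y z, h1 y z x, h1 z x y]
  -- Substitute `φ x` for `x` in `h2`: only the `ξ`-component of the first argument can contribute.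
  have h3 (x y z : V) : a x y z = η x * a ξ y z := by
    have h := h2 (φ x) y z
    rw [hφ, ← neg_one_smul ℝ x, hadd, hsmul, hsmul] at h
    linarith
  have h4 (y z : V) : a ξ y z = 0 := by
    have h := hcyc ξ y z
    rw [h3 y, h3 z, hskew ξ z ξ, hξ, hξ] at h
    linarith
  rw [h3, h4, mul_zero]

end Algebra

/-! ### Parallelism of `φ` and `ξ` on a cosymplectic manifold -/

namespace AlmostContactMetric

set_option linter.unusedSectionVars false

variable {E : Type*} [NormedAddCommGroup E] [NormedSpace ℝ E] [FiniteDimensional ℝ E]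
  {M : Type*} [TopologicalSpace M] [ChartedSpace E M] [IsManifold 𝓘(ℝ, E) ∞ M]
  [RiemannianBundle (fun x : M ↦ TangentSpace 𝓘(ℝ, E) x)]
  (S : AlmostContactMetric E M) {p : M} {X Y Z : Π x : M, TangentSpace 𝓘(ℝ, E) x}

theorem inner_xi (u : TangentSpace 𝓘(ℝ, E) p) : ⟪S.phi p u, S.xi p⟫_ℝ = 0 := by
  rw [← S.eta_eq_inner, S.eta_phi]

theorem inner_phi_left (u v : TangentSpace 𝓘(ℝ, E) p) :
    ⟪S.phi p u, v⟫_ℝ = -⟪u, S.phi p v⟫_ℝ := by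
  have h := S.inner_phi_phi p u (S.phi p v)
  rw [S.phi_phi, S.eta_phi, inner_add_right, inner_neg_right, inner_smul_right, S.inner_xi] at h
  linarith

theorem inner_phi_right (u v : TangentSpace 𝓘(ℝ, E) p) :
    ⟪u, S.phi p v⟫_ℝ = -⟪v, S.phi p u⟫_ℝ := by
  rw [← S.inner_phi_left, real_inner_comm]

/-- The vector field `φ Y`. -/
noncomputable def phiField (Y : Π x : M, TangentSpace 𝓘(ℝ, E) x) :
    Π x : M, TangentSpace 𝓘(ℝ, E) x :=
  fun y ↦ S.phi y (Y y)

theorem mdifferentiableAt_phiField (hY : MDiffAt (T% Y) p) :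
    MDiffAt (T% (S.phiField Y)) p :=
  MDifferentiableAt.clm_bundle_apply (F₁ := E) (F₂ := E)
    (E₁ := fun x : M ↦ TangentSpace 𝓘(ℝ, E) x)
    (E₂ := fun x : M ↦ TangentSpace 𝓘(ℝ, E) x)
    ((S.contMDiff_phi.contMDiffAt (x := p)).mdifferentiableAt (by simp)) hY

theorem isSmoothField_xi : IsSmoothField S.xi := S.contMDiff_xi

variable [IsContMDiffRiemannianBundle 𝓘(ℝ, E) ∞ E (fun x : M ↦ TangentSpace 𝓘(ℝ, E) x)]

/-- The covariant derivative `v ↦ (∇_v φ) Y`. -/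
noncomputable def nablaPhi (Y : Π x : M, TangentSpace 𝓘(ℝ, E) x) (p : M) :
    TangentSpace 𝓘(ℝ, E) p →L[ℝ] TangentSpace 𝓘(ℝ, E) p :=
  leviCivita E M (S.phiField Y) p - S.phi p ∘L leviCivita E M Y p

theorem nablaPhi_apply (v : TangentSpace 𝓘(ℝ, E) p) :
    S.nablaPhi Y p v = leviCivita E M (S.phiField Y) p v - S.phi p (leviCivita E M Y p v) := rfl

theorem leviCivita_phiField (v : TangentSpace 𝓘(ℝ, E) p) :
    leviCivita E M (S.phiField Y) p v = S.nablaPhi Y p v + S.phi p (leviCivita E M Y p v) := by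
  rw [nablaPhi_apply, sub_add_cancel]

/-- Since `φ` is skew for a parallel metric, so is its covariant derivative. As the right side sees
only `Y p`, this also gives tensoriality in `Y`. -/
theorem inner_nablaPhi (hY : MDiffAt (T% Y) p) (hZ : MDiffAt (T% Z) p)
    (v : TangentSpace 𝓘(ℝ, E) p) :
    ⟪S.nablaPhi Y p v, Z p⟫_ℝ = -⟪S.nablaPhi Z p v, Y p⟫_ℝ := by
  have h1 := leviCivita_metric_apply (S.mdifferentiableAt_phiField hY) hZ v
  have h2 := leviCivita_metric_apply (S.mdifferentiableAt_phiField hZ) hY v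
  have h3 : (fun y ↦ ⟪S.phiField Y y, Z y⟫_ℝ) = -fun y ↦ ⟪S.phiField Z y, Y y⟫_ℝ := by
    ext y
    rw [Pi.neg_apply]
    unfold phiField
    rw [S.inner_phi_left, real_inner_comm]
  rw [h3, mvfderiv_neg, neg_apply, h2, leviCivita_phiField, leviCivita_phiField, inner_add_left,
    inner_add_left] at h1
  unfold phiField at h1
  rw [S.inner_phi_left, S.inner_phi_left, S.inner_phi_left, S.inner_phi_left] at h1
  linarith [S.inner_phi_right (Z p) (leviCivita E M Y p v),
    S.inner_phi_right (Y p) (leviCivita E M Z p v)]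

theorem nablaPhi_congr {Y' : Π x : M, TangentSpace 𝓘(ℝ, E) x} (hY : MDiffAt (T% Y) p)
    (hY' : MDiffAt (T% Y') p) (h : Y p = Y' p) : S.nablaPhi Y p = S.nablaPhi Y' p := by
  ext1 v
  refine ext_inner_field fun Z hZ ↦ ?_
  rw [S.inner_nablaPhi hY hZ, S.inner_nablaPhi hY' hZ, h]

theorem nablaPhi_xi (v : TangentSpace 𝓘(ℝ, E) p) :
    S.nablaPhi S.xi p v = -S.phi p (leviCivita E M S.xi p v) := by
  have h : S.phiField S.xi = 0 := funext fun y ↦ S.phi_xi y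
  rw [nablaPhi_apply, h, CovariantDerivative.zero]
  exact zero_sub _

theorem inner_leviCivita_xi_xi (v : TangentSpace 𝓘(ℝ, E) p) :
    ⟪leviCivita E M S.xi p v, S.xi p⟫_ℝ = 0 := by
  have hξ := S.isSmoothField_xi.mdifferentiableAt p
  have h := leviCivita_metric_apply hξ hξ v
  have h1 : (fun y ↦ ⟪S.xi y, S.xi y⟫_ℝ) = fun _ ↦ 1 :=
    funext fun y ↦ by rw [← S.eta_eq_inner, S.eta_xi]
  rw [h1, mvfderiv_const, real_inner_comm _ (S.xi p)] at h
  simp only [zero_apply] at h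
  linarith

namespace IsCosymplectic

variable {S} (hS : S.IsCosymplectic)
include hS

/-- For a torsion-free metric connection, `dη = 0` says that `∇η`, the form dual to `∇ξ`, is
symmetric. -/
theorem inner_leviCivita_xi_comm (hX : IsSmoothField X) (hY : IsSmoothField Y) :
    ⟪leviCivita E M S.xi p (X p), Y p⟫_ℝ = ⟪leviCivita E M S.xi p (Y p), X p⟫_ℝ := by
  have h := hS.eta_closed X Y hX hY p
  have hX' := hX.mdifferentiableAt p
  have hY' := hY.mdifferentiableAt p
  have hξ := S.isSmoothField_xi.mdifferentiableAt p
  unfold twiceExtDeriv at h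
  simp only [S.eta_eq_inner] at h
  rw [leviCivita_metric_apply hY' hξ, leviCivita_metric_apply hX' hξ, ← leviCivita_sub hX' hY',
    inner_sub_left, real_inner_comm _ (Y p), real_inner_comm _ (X p)] at h
  linarith

theorem leviCivita_xi_xi [T2Space M] : leviCivita E M S.xi p (S.xi p) = 0 := by
  refine ext_inner_right ℝ fun v ↦ ?_
  obtain ⟨Y, hY, rfl⟩ := exists_isSmoothField_apply_eq v
  rw [hS.inner_leviCivita_xi_comm S.isSmoothField_xi hY, S.inner_leviCivita_xi_xi,
    inner_zero_left]

/-- For a torsion-free connection the exterior derivative of `Φ` is, up to sign and factor, the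
cyclic sum of `∇Φ`. -/
theorem nablaPhi_cyclic (hX : IsSmoothField X) (hY : IsSmoothField Y) (hZ : IsSmoothField Z) :
    ⟪S.nablaPhi Y p (X p), Z p⟫_ℝ + ⟪S.nablaPhi Z p (Y p), X p⟫_ℝ +
      ⟪S.nablaPhi X p (Z p), Y p⟫_ℝ = 0 := by
  have h := hS.fundForm_closed X Y Z hX hY hZ p
  have hX' := hX.mdifferentiableAt p
  have hY' := hY.mdifferentiableAt p
  have hZ' := hZ.mdifferentiableAt p
  have hd {X Y Z : Π x : M, TangentSpace 𝓘(ℝ, E) x} (hY : MDiffAt (T% Y) p)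
      (hZ : MDiffAt (T% Z) p) : mvfderiv 𝓘(ℝ, E) (S.fundForm Y Z) p (X p) =
      ⟪leviCivita E M Y p (X p), S.phi p (Z p)⟫_ℝ - ⟪S.nablaPhi Y p (X p), Z p⟫_ℝ -
        ⟪leviCivita E M Z p (X p), S.phi p (Y p)⟫_ℝ := by
    have h := leviCivita_metric_apply hY (S.mdifferentiableAt_phiField hZ) (X p)
    rw [leviCivita_phiField, inner_add_right, real_inner_comm _ (Y p), S.inner_nablaPhi hZ hY,
      real_inner_comm _ (Y p), S.inner_phi_left] at h
    refine Eq.trans h ?_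
    unfold phiField
    ring
  unfold thriceExtDerivFundForm at h
  rw [hd hY' hZ', hd hZ' hX', hd hX' hY'] at h
  unfold fundForm at h
  rw [← leviCivita_sub hX' hY', ← leviCivita_sub hY' hZ', ← leviCivita_sub hZ' hX',
    inner_sub_left, inner_sub_left, inner_sub_left] at h
  linarith

/-- Writing every bracket of the Nijenhuis tensor as a difference of covariant derivatives cancels
all terms except those in `∇φ`; the `dη` term is zero because `η` is closed. -/
theorem nablaPhi_normal (hX : IsSmoothField X) (hY : IsSmoothField Y) :
    S.nablaPhi Y p (S.phi p (X p)) - S.nablaPhi X p (S.phi p (Y p)) +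
      S.phi p (S.nablaPhi X p (Y p)) - S.phi p (S.nablaPhi Y p (X p)) = 0 := by
  have h := hS.normal X Y hX hY p
  have hX' := hX.mdifferentiableAt p
  have hY' := hY.mdifferentiableAt p
  have hφX := S.mdifferentiableAt_phiField hX'
  have hφY := S.mdifferentiableAt_phiField hY'
  have h1 := leviCivita_sub hX' hY'
  have h2 := leviCivita_sub hφX hφY
  have h3 := leviCivita_sub hφX hY'
  have h4 := leviCivita_sub hX' hφY
  rw [leviCivita_phiField] at h3 h4
  rw [leviCivita_phiField, leviCivita_phiField] at h2
  rw [hS.eta_closed X Y hX hY, zero_smul, add_zero] at h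
  unfold nijenhuis at h
  change S.phi p (S.phi p (mlieBracket 𝓘(ℝ, E) X Y p)) +
    mlieBracket 𝓘(ℝ, E) (S.phiField X) (S.phiField Y) p -
    S.phi p (mlieBracket 𝓘(ℝ, E) (S.phiField X) Y p) -
    S.phi p (mlieBracket 𝓘(ℝ, E) X (S.phiField Y) p) = 0 at h
  rw [← h1, ← h2, ← h3, ← h4] at h
  simp only [map_sub, map_add] at h
  rw [← h]
  unfold phiField
  abel

theorem nablaPhi_eq_zero [T2Space M] (hY : MDiffAt (T% Y) p) : S.nablaPhi Y p = 0 := by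
  have hext (y : TangentSpace 𝓘(ℝ, E) p) :=
    mdifferentiableAt_extend (x := p) (V := (TangentSpace 𝓘(ℝ, E) : M → Type _)) 𝓘(ℝ, E) E y
  let a (x y z : TangentSpace 𝓘(ℝ, E) p) : ℝ := ⟪S.nablaPhi (extend E y) p x, z⟫_ℝ
  have ha {Y : Π x : M, TangentSpace 𝓘(ℝ, E) x} (hY : MDiffAt (T% Y) p)
      (x z : TangentSpace 𝓘(ℝ, E) p) : a x (Y p) z = ⟪S.nablaPhi Y p x, z⟫_ℝ := by
    simp only [a]
    rw [S.nablaPhi_congr (hext (Y p)) hY (extend_apply_self E _)]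
  have key : ∀ x y z, a x y z = 0 := by
    refine eq_zero_of_skew_of_cyclic (S.phi_phi p) ?_ ?_ ?_ ?_ ?_ ?_
    · intro x x' y z
      simp only [a, map_add, inner_add_left]
    · intro c x y z
      simp only [a, map_smul, inner_smul_left, conj_trivial]
    · intro x y z
      have h := S.inner_nablaPhi (hext y) (hext z) x
      rwa [extend_apply_self, extend_apply_self] at h
    · intro x y z
      obtain ⟨X, hX, rfl⟩ := exists_isSmoothField_apply_eq x
      obtain ⟨Y, hY, rfl⟩ := exists_isSmoothField_apply_eq y
      obtain ⟨Z, hZ, rfl⟩ := exists_isSmoothField_apply_eq z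
      rw [ha (hX.mdifferentiableAt p), ha (hY.mdifferentiableAt p), ha (hZ.mdifferentiableAt p)]
      exact hS.nablaPhi_cyclic hX hY hZ
    · intro x y z
      obtain ⟨X, hX, rfl⟩ := exists_isSmoothField_apply_eq x
      obtain ⟨Y, hY, rfl⟩ := exists_isSmoothField_apply_eq y
      simp only [ha (hX.mdifferentiableAt p), ha (hY.mdifferentiableAt p)]
      have h := congrArg (fun u ↦ ⟪u, z⟫_ℝ) (hS.nablaPhi_normal (p := p) hX hY)
      simp only [inner_sub_left, inner_add_left, S.inner_phi_left, inner_zero_left] at h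
      linarith
    · intro z
      rw [ha (S.isSmoothField_xi.mdifferentiableAt p), S.nablaPhi_xi, hS.leviCivita_xi_xi,
        map_zero, neg_zero, inner_zero_left]
  ext1 x
  refine ext_inner_right ℝ fun z ↦ ?_
  rw [← ha hY, key, zero_apply, inner_zero_left]

theorem leviCivita_phiField_eq [T2Space M] (hY : MDiffAt (T% Y) p)
    (v : TangentSpace 𝓘(ℝ, E) p) :
    leviCivita E M (S.phiField Y) p v = S.phi p (leviCivita E M Y p v) := by
  rw [leviCivita_phiField, hS.nablaPhi_eq_zero hY, zero_apply, zero_add]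

/-- Differentiating `φξ = 0` with `φ` parallel gives `φ(∇_v ξ) = 0`, so `∇_v ξ` is a multiple of
`ξ`; it is also orthogonal to the unit field `ξ`. -/
theorem leviCivita_xi [T2Space M] (v : TangentSpace 𝓘(ℝ, E) p) :
    leviCivita E M S.xi p v = 0 := by
  have h1 := S.nablaPhi_xi v
  rw [hS.nablaPhi_eq_zero (S.isSmoothField_xi.mdifferentiableAt p), zero_apply, eq_comm,
    neg_eq_zero] at h1
  have h2 := S.phi_phi p (leviCivita E M S.xi p v)
  rw [h1, map_zero, S.eta_eq_inner, S.inner_leviCivita_xi_xi, zero_smul, add_zero, eq_comm,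
    neg_eq_zero] at h2
  exact h2

end IsCosymplectic

end AlmostContactMetric

/-- The trace of a bilinear map does not depend on the orthonormal basis. -/
theorem sum_apply_orthonormalBasis {ι κ V W : Type*} [Fintype ι] [Fintype κ]
    [NormedAddCommGroup V] [InnerProductSpace ℝ V] [AddCommGroup W] [Module ℝ W]
    (B : V →ₗ[ℝ] V →ₗ[ℝ] W) (e : OrthonormalBasis ι ℝ V) (f : OrthonormalBasis κ ℝ V) :
    ∑ i, B (e i) (e i) = ∑ j, B (f j) (f j) := by
  classical
  have h (i : ι) : B (e i) (e i) = ∑ j, ∑ k, (⟪f j, e i⟫_ℝ * ⟪e i, f k⟫_ℝ) • B (f j) (f k) := by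
    conv_lhs => rw [← f.sum_repr' (e i)]
    simp only [map_sum, LinearMap.sum_apply, map_smul, LinearMap.smul_apply, Finset.smul_sum]
    rw [Finset.sum_comm]
    refine Finset.sum_congr rfl fun j _ ↦ Finset.sum_congr rfl fun k _ ↦ ?_
    rw [smul_smul, real_inner_comm (f k) (e i), mul_comm]
  simp only [h]
  rw [Finset.sum_comm]
  refine Finset.sum_congr rfl fun j _ ↦ ?_
  rw [Finset.sum_comm]
  simp only [← Finset.sum_smul, e.sum_inner_mul_inner]
  simp [orthonormal_iff_ite.1 f.orthonormal]

/-! ### O'Neill's tensor with a vertical first argument -/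

section ONeill

set_option linter.unusedSectionVars false

variable {E : Type*} [NormedAddCommGroup E] [NormedSpace ℝ E] [FiniteDimensional ℝ E]
  {M : Type*} [TopologicalSpace M] [ChartedSpace E M] [IsManifold 𝓘(ℝ, E) ∞ M]
  [RiemannianBundle (fun x : M ↦ TangentSpace 𝓘(ℝ, E) x)]
  [IsContMDiffRiemannianBundle 𝓘(ℝ, E) ∞ E (fun x : M ↦ TangentSpace 𝓘(ℝ, E) x)]
  {E' : Type*} [NormedAddCommGroup E'] [NormedSpace ℝ E'] [FiniteDimensional ℝ E']
  {N : Type*} [TopologicalSpace N] [ChartedSpace E' N] [IsManifold 𝓘(ℝ, E') ∞ N]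
  [RiemannianBundle (fun x : N ↦ TangentSpace 𝓘(ℝ, E') x)]
  [IsContMDiffRiemannianBundle 𝓘(ℝ, E') ∞ E' (fun x : N ↦ TangentSpace 𝓘(ℝ, E') x)]
  {F : M → N} {p : M} {V X Y Z : Π x : M, TangentSpace 𝓘(ℝ, E) x}

theorem contMDiffAt_extend (v : TangentSpace 𝓘(ℝ, E) p) :
    CMDiffAt ∞ (T% (extend E v : Π y : M, TangentSpace 𝓘(ℝ, E) y)) p :=
  (contMDiffOn_extend v).contMDiffAt ((chartAt E p).open_source.mem_nhds (mem_chart_source E p))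

theorem inner_leviCivita_of_inner_eq_zero (hY : MDiffAt (T% Y) p) (hZ : MDiffAt (T% Z) p)
    (h : ∀ q, ⟪Y q, Z q⟫_ℝ = 0) (v : TangentSpace 𝓘(ℝ, E) p) :
    ⟪leviCivita E M Y p v, Z p⟫_ℝ = -⟪Y p, leviCivita E M Z p v⟫_ℝ := by
  have h1 := leviCivita_metric_apply hY hZ v
  rw [funext h, mvfderiv_const] at h1
  simp only [zero_apply] at h1
  linarith

theorem inner_oneillT (hV : V p ∈ vertical E E' F p) :
    ⟪oneillT E E' F V Y p, Z p⟫_ℝ =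
      ⟪leviCivita E M (vertField E E' F Y) p (V p), horField E E' F Z p⟫_ℝ +
        ⟪leviCivita E M (horField E E' F Y) p (V p), vertField E E' F Z p⟫_ℝ := by
  unfold oneillT
  rw [Pi.add_apply, inner_add_left]
  congr 1
  · conv_lhs => rw [horField, vertField_eq_self hV]
    exact Submodule.inner_starProjection_left_eq_right _ _ _
  · conv_lhs => rw [vertField, vertField_eq_self hV]
    exact Submodule.inner_starProjection_left_eq_right _ _ _

namespace IsRiemannianSubmersion

variable (hF : IsRiemannianSubmersion E E' F)
include hF

/-- Skew-symmetry of `T_V` comes from differentiating the orthogonality of vertical and horizontal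
parts along `V`. -/
theorem inner_oneillT_comm (hV : V p ∈ vertical E E' F p) (hY : CMDiffAt ∞ (T% Y) p)
    (hZ : CMDiffAt ∞ (T% Z) p) :
    ⟪oneillT E E' F V Y p, Z p⟫_ℝ = -⟪oneillT E E' F V Z p, Y p⟫_ℝ := by
  have h {X : Π x : M, TangentSpace 𝓘(ℝ, E) x} (hX : CMDiffAt ∞ (T% X) p) :=
    (hF.contMDiffAt_horField hX).mdifferentiableAt (by simp)
  have v {X : Π x : M, TangentSpace 𝓘(ℝ, E) x} (hX : CMDiffAt ∞ (T% X) p) :=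
    (hF.contMDiffAt_vertField hX).mdifferentiableAt (by simp)
  rw [inner_oneillT hV, inner_oneillT hV,
    inner_leviCivita_of_inner_eq_zero (v hY) (h hZ)
      (fun q ↦ inner_vertical_horizontal (vertField_mem Y q) (horField_mem Z q)),
    inner_leviCivita_of_inner_eq_zero (h hY) (v hZ)
      (fun q ↦ inner_horizontal_vertical (horField_mem Y q) (vertField_mem Z q)),
    real_inner_comm _ (vertField E E' F Y p), real_inner_comm _ (horField E E' F Y p)]
  ring

/-- The bilinear form `(y, z) ↦ g(T_V y, z)` at a point. -/
noncomputable def oneillForm (hV : V p ∈ vertical E E' F p) :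
    TangentSpace 𝓘(ℝ, E) p →ₗ[ℝ] TangentSpace 𝓘(ℝ, E) p →ₗ[ℝ] ℝ :=
  have hcomm (u v : TangentSpace 𝓘(ℝ, E) p) :
      ⟪oneillT E E' F V (extend E u) p, v⟫_ℝ = -⟪oneillT E E' F V (extend E v) p, u⟫_ℝ := by
    have h := hF.inner_oneillT_comm hV (contMDiffAt_extend u) (contMDiffAt_extend v)
    rwa [extend_apply_self, extend_apply_self] at h
  LinearMap.mk₂ ℝ (fun u v ↦ ⟪oneillT E E' F V (extend E u) p, v⟫_ℝ)
    -- Linearity in the extended vector is not visible in the definition; skewness moves it to the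
    -- second slot, where it is.
    (fun u u' v ↦ by rw [hcomm, hcomm u, hcomm u', inner_add_right, neg_add])
    (fun c u v ↦ by rw [hcomm, hcomm u, inner_smul_right, smul_eq_mul, mul_neg])
    (fun u v v' ↦ inner_add_right _ _ _)
    (fun c u v ↦ inner_smul_right _ _ _)

theorem oneillForm_extend (hV : V p ∈ vertical E E' F p) (u v : TangentSpace 𝓘(ℝ, E) p) :
    hF.oneillForm hV u v = ⟪oneillT E E' F V (extend E u) p, v⟫_ℝ := rfl

theorem oneillForm_comm (hV : V p ∈ vertical E E' F p) (u v : TangentSpace 𝓘(ℝ, E) p) :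
    hF.oneillForm hV u v = -hF.oneillForm hV v u := by
  have h := hF.inner_oneillT_comm hV (contMDiffAt_extend u) (contMDiffAt_extend v)
  rwa [extend_apply_self, extend_apply_self] at h

theorem oneillForm_apply (hV : V p ∈ vertical E E' F p) (hY : CMDiffAt ∞ (T% Y) p)
    (v : TangentSpace 𝓘(ℝ, E) p) :
    hF.oneillForm hV (Y p) v = ⟪oneillT E E' F V Y p, v⟫_ℝ := by
  have h := hF.inner_oneillT_comm hV hY (contMDiffAt_extend v)
  rw [extend_apply_self] at h
  rw [hF.oneillForm_comm, h]
  rfl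

theorem oneillForm_of_vertical (hV : V p ∈ vertical E E' F p) (hY : CMDiffAt ∞ (T% Y) p)
    (hYv : ∀ q, Y q ∈ vertical E E' F q) {v : TangentSpace 𝓘(ℝ, E) p}
    (hv : v ∈ horizontal E E' F p) :
    hF.oneillForm hV (Y p) v = ⟪leviCivita E M Y p (V p), v⟫_ℝ := by
  have h1 : vertField E E' F Y = Y := funext fun q ↦ vertField_eq_self (hYv q)
  rw [hF.oneillForm_apply hV hY]
  unfold oneillT
  rw [Pi.add_apply, inner_add_left, inner_vertical_horizontal (vertField_mem _ _) hv, add_zero,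
    h1]
  conv_lhs => rw [horField, vertField_eq_self hV]
  refine (Submodule.inner_starProjection_left_eq_right _ _ _).trans ?_
  rw [Submodule.starProjection_eq_self_iff.2 hv]

/-- This is integrability of the fibres: `F_*∇_X Y = F_*∇_Y X` by the symmetry of the second
fundamental form, which on vertical fields is `-F_*∇_X Y`. -/
theorem inner_leviCivita_comm_of_vertical (hX : MDiffAt (T% X) p) (hY : MDiffAt (T% Y) p)
    (hXv : ∀ q, X q ∈ vertical E E' F q) (hYv : ∀ q, Y q ∈ vertical E E' F q)
    {v : TangentSpace 𝓘(ℝ, E) p} (hv : v ∈ horizontal E E' F p) :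
    ⟪leviCivita E M Y p (X p), v⟫_ℝ = ⟪leviCivita E M X p (Y p), v⟫_ℝ := by
  have hs : CMDiffAt ∞ F p := hF.smooth.contMDiffAt
  have h := secondFundForm_comm hs hX hY
  rw [secondFundForm_of_vertical hs.continuousAt X hYv,
    secondFundForm_of_vertical hs.continuousAt Y hXv, neg_inj] at h
  rw [← hF.inner_mfderiv hv, h, hF.inner_mfderiv hv]

end IsRiemannianSubmersion

end ONeill

/-! ### Orthonormal bases adapted to `φ` and `ξ` -/

section Adapted

set_option linter.unusedSectionVars false

variable {E : Type*} [NormedAddCommGroup E] [NormedSpace ℝ E] [FiniteDimensional ℝ E]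
  {M : Type*} [TopologicalSpace M] [ChartedSpace E M] [IsManifold 𝓘(ℝ, E) ∞ M]
  [RiemannianBundle (fun x : M ↦ TangentSpace 𝓘(ℝ, E) x)]
  {E' : Type*} [NormedAddCommGroup E'] [NormedSpace ℝ E']
  {N : Type*} [TopologicalSpace N] [ChartedSpace E' N]
  {S : AlmostContactMetric E M} {F : M → N} {p : M}

/-- The horizontal space is `φ (ker F_*) + ⟨ξ⟩` at every point. -/
def IsLagrangian (S : AlmostContactMetric E M) (E' : Type*) [NormedAddCommGroup E']
    [NormedSpace ℝ E'] {N : Type*} [TopologicalSpace N] [ChartedSpace E' N] (F : M → N) : Prop :=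
  ∀ p : M, horizontal E E' F p =
    (vertical E E' F p).map (S.phi p).toLinearMap ⊔ Submodule.span ℝ {S.xi p}

namespace IsLagrangian

variable (hL : IsLagrangian S E' F)
include hL

theorem xi_mem (p : M) : S.xi p ∈ horizontal E E' F p := by
  rw [hL p]
  exact Submodule.mem_sup_right (Submodule.mem_span_singleton_self _)

theorem phi_mem {v : TangentSpace 𝓘(ℝ, E) p} (hv : v ∈ vertical E E' F p) :
    S.phi p v ∈ horizontal E E' F p := by
  rw [hL p]
  exact Submodule.mem_sup_left (Submodule.mem_map_of_mem hv)

theorem eta_eq_zero {v : TangentSpace 𝓘(ℝ, E) p} (hv : v ∈ vertical E E' F p) :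
    S.eta p v = 0 := by
  rw [S.eta_eq_inner, inner_vertical_horizontal hv (hL.xi_mem p)]

theorem mem_vertical_iff {v : TangentSpace 𝓘(ℝ, E) p} :
    v ∈ vertical E E' F p ↔
      (∀ u ∈ vertical E E' F p, ⟪S.phi p u, v⟫_ℝ = 0) ∧ ⟪S.xi p, v⟫_ℝ = 0 := by
  rw [mem_vertical_iff_inner]
  refine ⟨fun h ↦ ⟨fun u hu ↦ h _ (hL.phi_mem hu), h _ (hL.xi_mem p)⟩, fun ⟨h1, h2⟩ u hu ↦ ?_⟩
  rw [hL p, Submodule.mem_sup] at hu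
  obtain ⟨_, ⟨w, hw, rfl⟩, z, hz, rfl⟩ := hu
  obtain ⟨c, rfl⟩ := Submodule.mem_span_singleton.1 hz
  rw [inner_add_left, inner_smul_left, h2, mul_zero, add_zero]
  exact h1 w hw

/-- The orthonormal basis `u_j, φ u_j, ξ` of the tangent space, where `u_j` is an orthonormal
basis of the vertical space. -/
theorem exists_orthonormalBasis {ι : Type*} [Fintype ι]
    (u : OrthonormalBasis ι ℝ (vertical E E' F p)) :
    ∃ e : OrthonormalBasis (ι ⊕ ι ⊕ Unit) ℝ (TangentSpace 𝓘(ℝ, E) p),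
      (∀ j, e (.inl j) = u j) ∧ (∀ j, e (.inr (.inl j)) = S.phi p (u j)) ∧
        e (.inr (.inr ())) = S.xi p := by
  classical
  let f : ι ⊕ ι ⊕ Unit → TangentSpace 𝓘(ℝ, E) p :=
    Sum.elim (fun j ↦ (u j : TangentSpace 𝓘(ℝ, E) p))
      (Sum.elim (fun j ↦ S.phi p (u j)) fun _ ↦ S.xi p)
  have huu (i j : ι) : ⟪(u i : TangentSpace 𝓘(ℝ, E) p), (u j : TangentSpace 𝓘(ℝ, E) p)⟫_ℝ =
      if i = j then 1 else 0 := by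
    have h := orthonormal_iff_ite.1 u.orthonormal i j
    rwa [Submodule.coe_inner] at h
  have hvh {a b : TangentSpace 𝓘(ℝ, E) p} (ha : a ∈ vertical E E' F p)
      (hb : b ∈ horizontal E E' F p) : ⟪a, b⟫_ℝ = 0 := inner_vertical_horizontal ha hb
  have hhv {a b : TangentSpace 𝓘(ℝ, E) p} (ha : a ∈ horizontal E E' F p)
      (hb : b ∈ vertical E E' F p) : ⟪a, b⟫_ℝ = 0 := inner_horizontal_vertical ha hb
  have hf : Orthonormal ℝ f := by
    rw [orthonormal_iff_ite]
    rintro (i | i | ⟨⟩) (j | j | ⟨⟩)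
    · simpa [f] using huu i j
    · simpa [f] using hvh (u i).2 (hL.phi_mem (u j).2)
    · simpa [f] using hvh (u i).2 (hL.xi_mem p)
    · simpa [f] using hhv (hL.phi_mem (u i).2) (u j).2
    · simp only [f, Sum.elim_inr, Sum.elim_inl, Sum.inr.injEq, Sum.inl.injEq]
      -- On vertical vectors `η` vanishes because `ξ` is horizontal, so `φ` is isometric there.
      rw [S.inner_phi_phi, hL.eta_eq_zero (u i).2, zero_mul, sub_zero, huu]
    · simpa [f] using S.inner_xi _
    · simpa [f] using hhv (hL.xi_mem p) (u j).2
    · simp only [f, Sum.elim_inr, Sum.elim_inl]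
      rw [real_inner_comm, S.inner_xi]
      simp
    · simp only [f, Sum.elim_inr]
      rw [← S.eta_eq_inner, S.eta_xi]
      simp
  have hmem (i) : f i ∈ Submodule.span ℝ (Set.range f) := Submodule.subset_span ⟨i, rfl⟩
  have hspan : ⊤ ≤ Submodule.span ℝ (Set.range f) := by
    intro v _
    have hu {w : TangentSpace 𝓘(ℝ, E) p} (hw : w ∈ vertical E E' F p) :
        w = ∑ j, u.repr ⟨w, hw⟩ j • (u j : TangentSpace 𝓘(ℝ, E) p) := by
      have h := congrArg Subtype.val (u.sum_repr ⟨w, hw⟩)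
      rw [Submodule.coe_sum] at h
      exact h.symm
    obtain ⟨a, ha, b, hb, rfl⟩ := exists_vertical_add_horizontal E' F v
    refine Submodule.add_mem _ ?_ ?_
    · rw [hu ha]
      exact Submodule.sum_mem _ fun j _ ↦ Submodule.smul_mem _ _ (hmem (.inl j))
    · rw [hL p, Submodule.mem_sup] at hb
      obtain ⟨_, ⟨w, hw, rfl⟩, z, hz, rfl⟩ := hb
      obtain ⟨c, rfl⟩ := Submodule.mem_span_singleton.1 hz
      refine Submodule.add_mem _ ?_ (Submodule.smul_mem _ _ (hmem (.inr (.inr ()))))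
      change S.phi p w ∈ _
      rw [hu hw, map_sum]
      refine Submodule.sum_mem _ fun j _ ↦ ?_
      rw [map_smul]
      exact Submodule.smul_mem _ _ (hmem (.inr (.inl j)))
  refine ⟨OrthonormalBasis.mk hf hspan, ?_, ?_, ?_⟩ <;> simp [f]

end IsLagrangian

end Adapted

/-! ### Tension field and trace in terms of `∑ j, ∇_{U_j} U_j` -/

section Harmonicity

set_option linter.unusedSectionVars false

variable {E : Type*} [NormedAddCommGroup E] [NormedSpace ℝ E] [FiniteDimensional ℝ E]
  {M : Type*} [TopologicalSpace M] [T2Space M] [ChartedSpace E M] [IsManifold 𝓘(ℝ, E) ∞ M]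
  [RiemannianBundle (fun x : M ↦ TangentSpace 𝓘(ℝ, E) x)]
  [IsContMDiffRiemannianBundle 𝓘(ℝ, E) ∞ E (fun x : M ↦ TangentSpace 𝓘(ℝ, E) x)]
  {E' : Type*} [NormedAddCommGroup E'] [NormedSpace ℝ E'] [FiniteDimensional ℝ E']
  {N : Type*} [TopologicalSpace N] [ChartedSpace E' N] [IsManifold 𝓘(ℝ, E') ∞ N]
  [RiemannianBundle (fun x : N ↦ TangentSpace 𝓘(ℝ, E') x)]
  [IsContMDiffRiemannianBundle 𝓘(ℝ, E') ∞ E' (fun x : N ↦ TangentSpace 𝓘(ℝ, E') x)]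
  {S : AlmostContactMetric E M} {F : M → N} {p : M}
  {ι : Type*} [Fintype ι] {u : OrthonormalBasis ι ℝ (vertical E E' F p)}
  {U : ι → Π x : M, TangentSpace 𝓘(ℝ, E) x}

/-- The tension field is minus the image of the trace of `∇` over the fibre. -/
theorem tension_eq_neg_mfderiv (hF : IsRiemannianSubmersion E E' F) (hL : IsLagrangian S E' F)
    (hU : ∀ j, IsSmoothField (U j)) (hUv : ∀ j q, U j q ∈ vertical E E' F q)
    (hUu : ∀ j, U j p = u j) :
    tension E E' F p =
      -mfderiv 𝓘(ℝ, E) 𝓘(ℝ, E') F p (∑ j, leviCivita E M (U j) p (U j p)) := by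
  have hs : CMDiffAt ∞ F p := hF.smooth.contMDiffAt
  obtain ⟨e, he1, he2, he3⟩ := hL.exists_orthonormalBasis u
  rw [tension_eq_sum hs, sum_apply_orthonormalBasis _ _ e, Fintype.sum_sum_type,
    Fintype.sum_sum_type]
  simp only [he1, he2, he3, Finset.univ_unique, Finset.sum_singleton, PUnit.default_eq_unit]
  rw [hF.secondFundFormAt_of_horizontal (hL.xi_mem p) (hL.xi_mem p), add_zero,
    Finset.sum_eq_zero (s := Finset.univ) (f := fun j ↦ secondFundFormAt hs (S.phi p (u j))
      (S.phi p (u j))) fun j _ ↦ hF.secondFundFormAt_of_horizontal (hL.phi_mem (u j).2)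
        (hL.phi_mem (u j).2), add_zero, map_sum, ← Finset.sum_neg_distrib]
  refine Finset.sum_congr rfl fun j _ ↦ ?_
  rw [← hUu, secondFundFormAt_apply hs ((hU j).mdifferentiableAt p) ((hU j).mdifferentiableAt p),
    secondFundForm_of_vertical hs.continuousAt _ (hUv j)]

/-- The trace is computed in the basis `u_j, φ u_j, ξ`. The factor 2 arises because `u_j` and `φ
u_j` contribute equally, the sign from moving `φ` across the inner product. -/
theorem traceAt_phi_oneillT (hS : S.IsCosymplectic) (hF : IsRiemannianSubmersion E E' F)
    (hL : IsLagrangian S E' F)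
    (hU : ∀ j, IsSmoothField (U j)) (hUv : ∀ j q, U j q ∈ vertical E E' F q)
    (hUu : ∀ j, U j p = u j) {V : Π x : M, TangentSpace 𝓘(ℝ, E) x} (hV : IsSmoothField V)
    (hVv : ∀ q, V q ∈ vertical E E' F q) :
    traceAt (fun Y q ↦ S.phi q (oneillT E E' F V Y q)) p =
      -2 * ⟪S.phi p (V p), ∑ j, leviCivita E M (U j) p (U j p)⟫_ℝ := by
  obtain ⟨e, he1, he2, he3⟩ := hL.exists_orthonormalBasis u
  let B : TangentSpace 𝓘(ℝ, E) p →ₗ[ℝ] TangentSpace 𝓘(ℝ, E) p →ₗ[ℝ] ℝ :=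
    (hF.oneillForm (hVv p)).compl₂ (S.phi p).toLinearMap
  have hB (x y : TangentSpace 𝓘(ℝ, E) p) :
      B x y = hF.oneillForm (hVv p) x (S.phi p y) := rfl
  have h1 : traceAt (fun Y q ↦ S.phi q (oneillT E E' F V Y q)) p =
      -∑ i, B (stdOrthonormalBasis ℝ (TangentSpace 𝓘(ℝ, E) p) i)
        (stdOrthonormalBasis ℝ (TangentSpace 𝓘(ℝ, E) p) i) := by
    unfold traceAt
    rw [← Finset.sum_neg_distrib]
    refine Finset.sum_congr rfl fun i _ ↦ ?_
    rw [S.inner_phi_left, hB, hF.oneillForm_extend]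
  have h2 (j : ι) : B (u j) (u j) = ⟪S.phi p (V p), leviCivita E M (U j) p (U j p)⟫_ℝ := by
    have hUj := (hU j).mdifferentiableAt p
    have hVp := hV.mdifferentiableAt p
    have hh : S.phi p (U j p) ∈ horizontal E E' F p := hL.phi_mem (hUv j p)
    -- `φV` is horizontal and `U_j` vertical everywhere. Differentiating their orthogonality along
    -- `U_j`, with `φ` parallel, yields `g(∇_{U_j} V, φU_j) = g(φV, ∇_{U_j} U_j)`.
    have h3 := inner_leviCivita_of_inner_eq_zero (S.mdifferentiableAt_phiField hVp) hUj
      (fun q ↦ inner_horizontal_vertical (hL.phi_mem (hVv q)) (hUv j q)) (U j p)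
    rw [hS.leviCivita_phiField_eq hVp, S.inner_phi_left, neg_inj] at h3
    rw [hB, ← hUu, hF.oneillForm_of_vertical (hVv p) ((hU j).contMDiffAt p) (hUv j) hh,
      hF.inner_leviCivita_comm_of_vertical hVp hUj hVv (hUv j) hh, h3]
    rfl
  -- Here `φ²u_j = -u_j`, and this sign cancels the one from the skewness of `T_V`.
  have h4 (j : ι) : B (S.phi p (u j)) (S.phi p (u j)) = B (u j) (u j) := by
    rw [hB, hB, S.phi_phi, hL.eta_eq_zero (u j).2, zero_smul, add_zero, map_neg,
      ← hF.oneillForm_comm]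
  have h5 : B (S.xi p) (S.xi p) = 0 := by
    rw [hB, S.phi_xi, map_zero]
  rw [h1, sum_apply_orthonormalBasis _ _ e, Fintype.sum_sum_type, Fintype.sum_sum_type]
  simp only [he1, he2, he3, Finset.univ_unique, Finset.sum_singleton, h5, h4, h2]
  rw [inner_sum]
  ring

/-- Since `ξ` is horizontal and parallel, differentiating `g(ξ, V) = 0` leaves only this term. So
the `ξ`-direction never obstructs harmonicity. -/
theorem inner_xi_leviCivita (hS : S.IsCosymplectic) (hL : IsLagrangian S E' F)
    {V : Π x : M, TangentSpace 𝓘(ℝ, E) x} (hV : IsSmoothField V)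
    (hVv : ∀ q, V q ∈ vertical E E' F q) (v : TangentSpace 𝓘(ℝ, E) p) :
    ⟪S.xi p, leviCivita E M V p v⟫_ℝ = 0 := by
  have h := inner_leviCivita_of_inner_eq_zero (S.isSmoothField_xi.mdifferentiableAt p)
    (hV.mdifferentiableAt p)
    (fun q ↦ inner_horizontal_vertical (hL.xi_mem q) (hVv q)) v
  rwa [hS.leviCivita_xi, inner_zero_left, eq_comm, neg_eq_zero] at h

theorem tension_eq_zero_iff (hS : S.IsCosymplectic) (hF : IsRiemannianSubmersion E E' F)
    (hL : IsLagrangian S E' F) (p : M) :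
    tension E E' F p = 0 ↔ ∀ V : Π x : M, TangentSpace 𝓘(ℝ, E) x, IsSmoothField V →
      (∀ q, V q ∈ vertical E E' F q) →
        traceAt (fun Y q ↦ S.phi q (oneillT E E' F V Y q)) p = 0 := by
  let u := stdOrthonormalBasis ℝ (vertical E E' F p)
  choose U hU hUv hUu using fun j ↦ hF.exists_isSmoothField_vertical (u j).2
  -- The tension vanishes iff the sum is vertical, which is tested against `φ (ker F_*)` and `ξ`.
  -- The trace formula controls the first test; the second always succeeds.
  rw [tension_eq_neg_mfderiv hF hL hU hUv hUu, neg_eq_zero, ← mem_vertical, hL.mem_vertical_iff]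
  constructor
  · rintro ⟨h, -⟩ V hV hVv
    rw [traceAt_phi_oneillT hS hF hL hU hUv hUu hV hVv, h _ (hVv p), mul_zero]
  · refine fun h ↦ ⟨fun v hv ↦ ?_, ?_⟩
    · obtain ⟨V, hV, hVv, rfl⟩ := hF.exists_isSmoothField_vertical hv
      have := h V hV hVv
      rw [traceAt_phi_oneillT hS hF hL hU hUv hUu hV hVv] at this
      linarith
    · rw [inner_sum]
      exact Finset.sum_eq_zero fun j _ ↦ inner_xi_leviCivita hS hL (hU j) (hUv j) _

end Harmonicity

end CosympSubm

theorem theorem16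
    {E : Type*} [NormedAddCommGroup E] [NormedSpace ℝ E] [FiniteDimensional ℝ E]
    {M : Type*} [TopologicalSpace M] [T2Space M] [ChartedSpace E M] [IsManifold 𝓘(ℝ, E) ∞ M]
    [RiemannianBundle (fun x : M ↦ TangentSpace 𝓘(ℝ, E) x)]
    [IsContMDiffRiemannianBundle 𝓘(ℝ, E) ∞ E (fun x : M ↦ TangentSpace 𝓘(ℝ, E) x)]
    {E' : Type*} [NormedAddCommGroup E'] [NormedSpace ℝ E'] [FiniteDimensional ℝ E']
    {N : Type*} [TopologicalSpace N] [T2Space N] [ChartedSpace E' N] [IsManifold 𝓘(ℝ, E') ∞ N]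
    [RiemannianBundle (fun y : N ↦ TangentSpace 𝓘(ℝ, E') y)]
    [IsContMDiffRiemannianBundle 𝓘(ℝ, E') ∞ E' (fun y : N ↦ TangentSpace 𝓘(ℝ, E') y)]
    (S : CosympSubm.AlmostContactMetric E M) (hS : S.IsCosymplectic)
    (F : M → N) (hF : CosympSubm.IsRiemannianSubmersion E E' F)
    (hanti : ∀ p : M, (CosympSubm.vertical E E' F p).map (S.phi p).toLinearMap ≤
      CosympSubm.horizontal E E' F p)
    (hsum : ∀ p : M,
      CosympSubm.horizontal E E' F p =
        (CosympSubm.vertical E E' F p).map (S.phi p).toLinearMap ⊔ Submodule.span ℝ {S.xi p} ∧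
      Disjoint ((CosympSubm.vertical E E' F p).map (S.phi p).toLinearMap)
        (Submodule.span ℝ {S.xi p})) :
    CosympSubm.IsHarmonic E E' F ↔
      ∀ V : Π x : M, TangentSpace 𝓘(ℝ, E) x, CosympSubm.IsSmoothField V →
        (∀ p : M, V p ∈ CosympSubm.vertical E E' F p) →
        ∀ p : M, CosympSubm.traceAt
          (fun Y q ↦ S.phi q (CosympSubm.oneillT E E' F V Y q)) p = 0 := by
  have hL : CosympSubm.IsLagrangian S E' F := fun p ↦ (hsum p).1
  constructor
  · intro h V hV hVv p
    exact (CosympSubm.tension_eq_zero_iff hS hF hL p).1 (h.2 p) V hV hVv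
  · exact fun h ↦ ⟨hF.smooth, fun p ↦ (CosympSubm.tension_eq_zero_iff hS hF hL p).2
      fun V hV hVv ↦ h V hV hVv p⟩
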